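/- Let $M\ge 1$, $N\ge 1$, and let $U\in\mathbb R^{M\times(M-1)}$ be the matrix with first row $-\mathbf 1^T$ above the identity $I_{M-1}$; write $A^\dagger$ for the Moore–Penrose pseudo-inverse of $A$. Let $\Sigma_\theta\in\mathbb R^{M\times M}$ be a known positive semidefinite matrix and $\Sigma_{\tilde\theta}=U^T\Sigma_\theta U$. The unknown parameter is $\alpha=[\mathrm{vech}(\tilde L)^T,\sigma^2]^T\in\mathbb R^{M(M-1)/2+1}$ with $\tilde L$ a symmetric $(M-1)\times(M-1)$ matrix and $\sigma^2\ge0$. For independent states $\theta[n]\sim\mathcal N(0,\Sigma_\theta)$ and noises $w[n]\sim\mathcal N(0,\sigma^2 I_M)$, $n=0,\dots,N-1$ (all independent), the observations are $\tilde p[n]=U^\dagger\big(U\tilde LU^T\theta[n]+w[n]\big)$. Put $$C(\alpha)=\tilde L\,\Sigma_{\tilde\theta}\,\tilde L+\sigma^2U^\dagger(U^\dagger)^T ,$$ and let $\Theta$ be the set of all $\alpha$ with $\sigma^2\ge 0$ and $C(\alpha)$ nonsingular (hence positive definite; automatic if $\sigma^2>0$). Let $\alpha\in\Theta$. (a) Each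 $\tilde p[n]$ is $\mathcal N(0,C(\alpha))$ distributed. For every $\beta\in\Theta$ the data $(\tilde p[0],\dots,\tilde p[N-1])$ have as Lebesgue density $f(\cdot;\beta)$ the product of the $\mathcal N(0,C(\beta))$ densities. At $\alpha$ the function $\log f$ (defined by this formula near $\alpha$) is differentiable in the parameter, and the scores $\partial_{\alpha_r}\log f$ are square integrable. (b) Let $\Psi$ be the $(M-1)^2\times\big(\tfrac{M(M-1)}2+1\big)$ matrix whose columns, in the order of $\mathrm{vech}(\tilde L)$, are $$\psi(l,k)=\big(1-\tfrac12\delta_{k,l}\big)\,\mathrm{vec}\big((E_{k,l}+E_{l,k})\Sigma_{\tilde\theta}\tilde L+\tilde L\Sigma_{\tilde\theta}(E_{k,l}+E_{l,k})\big),\qquad l\le k,\quad E_{k,l}=e_ke_l^T,$$ followed by the last column $\mathrm{vec}(U^\dagger(U^\dagger)^T)$. The columns of $\Psi$ are the vectorized partial derivatives of $C$ with respect to the entries of $\alpha$. With $Q=C(\alpha)^{-1}\otimes C(\alpha)^{-1}$, the Fisher information matrix $J(\alpha)_{r,s}=\mathrm E_\alpha[\partial_{\alpha_r}\log f\;\partial_{\alpha_s}\log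 f]$ is $$J(\alpha)=\tfrac N2\,\Psi^TQ\Psi ,$$ and the Cramér–Rao bound $B_{\mathrm{CRB}}(\alpha)=J(\alpha)^\dagger$ is $$B_{\mathrm{CRB}}(\alpha)=\tfrac2N\,(\Psi^TQ\Psi)^\dagger .$$ (c) Let $K\subseteq\Theta$ be any set of admissible parameters with $\alpha\in K$ at which derivatives within $K$ are unique (i.e. the tangent cone of $K$ at $\alpha$ spans a dense subspace; for instance a neighbourhood of $\alpha$ in $\Theta$). Let $\hat\alpha=[\mathrm{vech}(\hat{\tilde L})^T,\hat\sigma^2]^T$ be an estimator of $\alpha$ from the data with finite second moments under $\alpha$, which is unbiased at every $\beta\in K$, or, more generally, whose mean $\beta\mapsto\mathrm E_\beta[\hat\alpha]$ on $K$ has at $\alpha$ a derivative that is the identity on the range of $J(\alpha)$. Then $$\mathrm E_\alpha\big[(\hat\alpha-\alpha)(\hat\alpha-\alpha)^T\big]\succeq\tfrac2N(\Psi^TQ\Psi)^\dagger ,$$ $$\mathrm E_\alpha\big[(\mathrm{vech}(\hat{\tilde L})-\mathrm{vech}(\tilde L))(\mathrm{vech}(\hat{\tilde L})-\mathrm{vech}(\tilde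 L))^T\big]\succeq\big[B_{\mathrm{CRB}}(\alpha)\big]_{1:\frac{M(M-1)}2,\,1:\frac{M(M-1)}2},$$ $$\mathrm E_\alpha\big[(\hat\sigma^2-\sigma^2)^2\big]\ge\big[B_{\mathrm{CRB}}(\alpha)\big]_{\frac{M(M-1)}2+1,\,\frac{M(M-1)}2+1}.$$ -/

import Mathlib

open MeasureTheory ProbabilityTheory Matrix
open scoped Kronecker Topology

namespace GraphCRB

/-! ### Moore-Penrose pseudo-inverse of a real matrix -/

section PseudoInverse

variable {ι κ : Type*} [Fintype ι] [Fintype κ]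

/-- The four Penrose equations: `X` is the Moore-Penrose pseudo-inverse of `A`. -/
structure IsMoorePenrose (A : Matrix ι κ ℝ) (X : Matrix κ ι ℝ) : Prop where
  mul_mul_self : A * X * A = A
  mul_mul_inv : X * A * X = X
  symm_left : (A * X)ᵀ = A * X
  symm_right : (X * A)ᵀ = X * A

theorem IsMoorePenrose.unique {A : Matrix ι κ ℝ} {X Y : Matrix κ ι ℝ}
    (hX : IsMoorePenrose A X) (hY : IsMoorePenrose A Y) : X = Y := by
  have h1 : A * X = A * Y := by
    calc A * X = (A * X)ᵀ := hX.symm_left.symm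
      _ = ((A * Y) * (A * X))ᵀ := by rw [← Matrix.mul_assoc, hY.mul_mul_self]
      _ = (A * X) * (A * Y) := by rw [transpose_mul, hX.symm_left, hY.symm_left]
      _ = A * Y := by rw [← Matrix.mul_assoc, hX.mul_mul_self]
  have h2 : X * A = Y * A := by
    calc X * A = (X * A)ᵀ := hX.symm_right.symm
      _ = ((X * A) * (Y * A))ᵀ := by
          rw [Matrix.mul_assoc, ← Matrix.mul_assoc A, hY.mul_mul_self]
      _ = (Y * A) * (X * A) := by rw [transpose_mul, hX.symm_right, hY.symm_right]
      _ = Y * A := by rw [Matrix.mul_assoc, ← Matrix.mul_assoc A, hX.mul_mul_self]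
  calc X = X * A * X := hX.mul_mul_inv.symm
    _ = Y * A * X := by rw [h2]
    _ = Y * (A * X) := Matrix.mul_assoc _ _ _
    _ = Y * (A * Y) := by rw [h1]
    _ = Y := by rw [← Matrix.mul_assoc, hY.mul_mul_inv]

theorem IsMoorePenrose.transpose {A : Matrix ι κ ℝ} {X : Matrix κ ι ℝ}
    (h : IsMoorePenrose A X) : IsMoorePenrose Aᵀ Xᵀ where
  mul_mul_self := by
    rw [← transpose_mul, ← transpose_mul, ← Matrix.mul_assoc, h.mul_mul_self]
  mul_mul_inv := by
    rw [← transpose_mul, ← transpose_mul, ← Matrix.mul_assoc, h.mul_mul_inv]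
  symm_left := by rw [← transpose_mul, h.symm_right, h.symm_right]
  symm_right := by rw [← transpose_mul, h.symm_left, h.symm_left]

theorem exists_isMoorePenrose_of_symm [DecidableEq κ] {H : Matrix κ κ ℝ} (hH : H.IsHermitian) :
    ∃ X, IsMoorePenrose H X := by
  obtain ⟨V, d, hV1, hs⟩ : ∃ (V : Matrix κ κ ℝ) (d : κ → ℝ),
      Vᵀ * V = 1 ∧ H = V * diagonal d * Vᵀ := by
    refine ⟨(hH.eigenvectorUnitary : Matrix κ κ ℝ), hH.eigenvalues,
      Unitary.coe_star_mul_self hH.eigenvectorUnitary, ?_⟩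
    simpa [Unitary.conjStarAlgAut_apply, star_eq_conjTranspose] using hH.spectral_theorem
  have key : ∀ a b : κ → ℝ, (V * diagonal a * Vᵀ) * (V * diagonal b * Vᵀ)
      = V * diagonal (fun i => a i * b i) * Vᵀ := by
    intro a b
    calc _ = V * diagonal a * (Vᵀ * V) * diagonal b * Vᵀ := by simp only [Matrix.mul_assoc]
      _ = _ := by rw [hV1, Matrix.mul_one, Matrix.mul_assoc V, diagonal_mul_diagonal]
  have kt : ∀ a : κ → ℝ, (V * diagonal a * Vᵀ)ᵀ = V * diagonal a * Vᵀ := by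
    intro a
    simp [transpose_mul, Matrix.mul_assoc]
  subst hs
  refine ⟨V * diagonal (fun i => (d i)⁻¹) * Vᵀ, ?_, ?_, ?_, ?_⟩
  · rw [key, key]
    congr 3
    funext i
    exact mul_inv_mul_cancel _
  · rw [key, key]
    congr 3
    funext i
    by_cases h : d i = 0 <;> simp [h]
  · rw [key, kt]
  · rw [key, kt]

theorem exists_isMoorePenrose (A : Matrix ι κ ℝ) : ∃ X, IsMoorePenrose A X := by
  classical
  have hH : (Aᵀ * A).IsHermitian := by
    rw [IsHermitian, conjTranspose_eq_transpose_of_trivial, transpose_mul, transpose_transpose]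
  obtain ⟨Y, hY⟩ := exists_isMoorePenrose_of_symm hH
  have hYt : Yᵀ = Y := by
    have h := hY.transpose
    rw [transpose_mul, transpose_transpose] at h
    exact h.unique hY
  refine ⟨Y * Aᵀ, ?_, ?_, ?_, ?_⟩
  · have h0 : (A * (Y * Aᵀ) * A - A)ᵀ * (A * (Y * Aᵀ) * A - A) = 0 := by
      have h1 : Aᵀ * (A * (Y * Aᵀ) * A - A) = 0 := by
        rw [Matrix.mul_sub, sub_eq_zero]
        calc Aᵀ * (A * (Y * Aᵀ) * A) = Aᵀ * A * Y * (Aᵀ * A) := by simp only [Matrix.mul_assoc]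
          _ = Aᵀ * A := hY.mul_mul_self
      have h2 : (A * (Y * Aᵀ) * A - A)ᵀ = (Aᵀ * A * Y - 1) * Aᵀ := by
        simp only [transpose_sub, transpose_mul, transpose_transpose, hYt, Matrix.sub_mul,
          Matrix.one_mul, Matrix.mul_assoc]
      rw [h2, Matrix.mul_assoc, h1, Matrix.mul_zero]
    have h3 : (A * (Y * Aᵀ) * A - A) = 0 := by
      rw [← conjTranspose_eq_transpose_of_trivial] at h0
      exact conjTranspose_mul_self_eq_zero.1 h0
    exact sub_eq_zero.1 h3
  · calc Y * Aᵀ * A * (Y * Aᵀ) = Y * (Aᵀ * A) * Y * Aᵀ := by simp only [Matrix.mul_assoc]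
      _ = Y * Aᵀ := by rw [hY.mul_mul_inv]
  · simp only [transpose_mul, transpose_transpose, hYt, Matrix.mul_assoc]
  · have := hY.symm_right
    simpa only [Matrix.mul_assoc] using this

/-- The Moore-Penrose pseudo-inverse `A†`. -/
noncomputable def pinv (A : Matrix ι κ ℝ) : Matrix κ ι ℝ :=
  Classical.choose (exists_isMoorePenrose A)

theorem isMoorePenrose_pinv (A : Matrix ι κ ℝ) : IsMoorePenrose A (pinv A) :=
  Classical.choose_spec (exists_isMoorePenrose A)

/-- For a matrix of full column rank, `A† = (Aᵀ A)⁻¹ Aᵀ`. -/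
theorem pinv_eq_of_isUnit [DecidableEq κ] (A : Matrix ι κ ℝ) (h : IsUnit (Aᵀ * A).det) :
    pinv A = (Aᵀ * A)⁻¹ * Aᵀ := by
  refine (isMoorePenrose_pinv A).unique ⟨?_, ?_, ?_, ?_⟩
  · rw [Matrix.mul_assoc, Matrix.mul_assoc, nonsing_inv_mul _ h, Matrix.mul_one]
  · rw [Matrix.mul_assoc _ _ A, nonsing_inv_mul _ h, Matrix.one_mul]
  · simp only [transpose_mul, transpose_transpose, transpose_nonsing_inv, Matrix.mul_assoc]
  · rw [Matrix.mul_assoc, nonsing_inv_mul _ h, transpose_one]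

end PseudoInverse

/-! ### Parameters: `M = m + 1` buses, reduced matrices of size `M - 1 = m` -/

/-- Positions `(k, l)`, `l ≤ k`, of the lower triangle (diagonal included) of an `m × m` matrix. -/
abbrev VechIdx (m : ℕ) : Type := {p : Fin m × Fin m // p.2 ≤ p.1}

/-- Index set of `α = [vech(L̃)ᵀ, σ²]ᵀ`: the lower-triangular positions, then one index for `σ²`. -/
abbrev ParamIdx (m : ℕ) : Type := VechIdx m ⊕ Unit

/-- Parameter vectors `α`. -/
abbrev Param (m : ℕ) : Type := ParamIdx m → ℝ

/-- The symmetric matrix `L̃` whose lower triangle is the first block of `α`. -/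
def redLap {m : ℕ} (α : Param m) : Matrix (Fin m) (Fin m) ℝ :=
  Matrix.of fun i j => α (Sum.inl ⟨(max i j, min i j), min_le_max⟩)

/-- The noise variance `σ²`, the last entry of `α`. -/
def noiseVar {m : ℕ} (α : Param m) : ℝ := α (Sum.inr ())

/-! ### The observation model -/

/-- The `M × (M-1)` matrix `U` with first row `-1ᵀ` above the identity. -/
def matU (m : ℕ) : Matrix (Fin (m + 1)) (Fin m) ℝ :=
  Matrix.of fun i j => Fin.cases (-1) (fun k => if k = j then 1 else 0) i

/-- `Σ_θ̃ = Uᵀ Σ_θ U`. -/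
def redStateCov {m : ℕ} (Sθ : Matrix (Fin (m + 1)) (Fin (m + 1)) ℝ) : Matrix (Fin m) (Fin m) ℝ :=
  (matU m)ᵀ * Sθ * matU m

/-- `U† (U†)ᵀ`. -/
noncomputable def noiseShape (m : ℕ) : Matrix (Fin m) (Fin m) ℝ :=
  pinv (matU m) * (pinv (matU m))ᵀ

/-- `L̃ Σ_θ̃ L̃ + σ² U† (U†)ᵀ`. -/
noncomputable def obsCov {m : ℕ} (Sθ : Matrix (Fin (m + 1)) (Fin (m + 1)) ℝ) (α : Param m) :
    Matrix (Fin m) (Fin m) ℝ :=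
  redLap α * redStateCov Sθ * redLap α + noiseVar α • noiseShape m

/-- The admissible parameters: symmetric `L̃` (no other constraint), `σ² ≥ 0`, and a nonsingular
observation covariance (automatic when `σ² > 0` and `Σ_θ ⪰ 0`). -/
def paramSpace {m : ℕ} (Sθ : Matrix (Fin (m + 1)) (Fin (m + 1)) ℝ) : Set (Param m) :=
  {α | 0 ≤ noiseVar α ∧ (obsCov Sθ α).PosDef}

/-- The law of one reduced observation `p̃ = U† p`, where `p = L θ + w`, `L = U L̃ Uᵀ`, and
`θ ~ N(0, Σ_θ)`, `w ~ N(0, σ² I)` are independent. -/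
noncomputable def snapshotLaw {m : ℕ} (Sθ : Matrix (Fin (m + 1)) (Fin (m + 1)) ℝ) (α : Param m) :
    Measure (EuclideanSpace ℝ (Fin m)) :=
  ((multivariateGaussian 0 Sθ).prod
      (multivariateGaussian 0 (noiseVar α • (1 : Matrix (Fin (m + 1)) (Fin (m + 1)) ℝ)))).map
    fun z => WithLp.toLp 2
      (pinv (matU m) *ᵥ ((matU m * redLap α * (matU m)ᵀ) *ᵥ z.1.ofLp + z.2.ofLp))

/-- The law of the data `p̃[0], …, p̃[N-1]` (independent over time). -/
noncomputable def dataLaw {m : ℕ} (N : ℕ) (Sθ : Matrix (Fin (m + 1)) (Fin (m + 1)) ℝ)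
    (α : Param m) : Measure (Fin N → EuclideanSpace ℝ (Fin m)) :=
  Measure.pi fun _ => snapshotLaw Sθ α

/-- The joint density of the data: the product of the `N(0, obsCov)` densities. -/
noncomputable def dataDensity {m N : ℕ} (Sθ : Matrix (Fin (m + 1)) (Fin (m + 1)) ℝ)
    (α : Param m) (x : Fin N → EuclideanSpace ℝ (Fin m)) : ℝ :=
  ∏ n, (Real.sqrt ((2 * Real.pi) ^ m * (obsCov Sθ α).det))⁻¹ *
    Real.exp (-((x n).ofLp ⬝ᵥ (obsCov Sθ α)⁻¹ *ᵥ (x n).ofLp) / 2)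

/-- The log-likelihood of the data. -/
noncomputable def logLik {m N : ℕ} (Sθ : Matrix (Fin (m + 1)) (Fin (m + 1)) ℝ)
    (x : Fin N → EuclideanSpace ℝ (Fin m)) (α : Param m) : ℝ :=
  Real.log (dataDensity Sθ α x)

/-- The score `∂ log f(x; α) / ∂ α_r`. -/
noncomputable def score {m N : ℕ} (Sθ : Matrix (Fin (m + 1)) (Fin (m + 1)) ℝ) (α : Param m)
    (r : ParamIdx m) (x : Fin N → EuclideanSpace ℝ (Fin m)) : ℝ :=
  lineDeriv ℝ (logLik Sθ x) α (Pi.single r 1)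

/-- The Fisher information matrix `J(α)`, `J_{r,s} = E[∂_r log f · ∂_s log f]`. -/
noncomputable def fisherInfo {m : ℕ} (N : ℕ) (Sθ : Matrix (Fin (m + 1)) (Fin (m + 1)) ℝ)
    (α : Param m) : Matrix (ParamIdx m) (ParamIdx m) ℝ :=
  Matrix.of fun r s => ∫ x, score Sθ α r x * score Sθ α s x ∂(dataLaw N Sθ α)

/-- The Cramér-Rao bound `B_CRB(α) = J(α)†`; this is `J(α)⁻¹` whenever `J(α)` is invertible. -/
noncomputable def crb {m : ℕ} (N : ℕ) (Sθ : Matrix (Fin (m + 1)) (Fin (m + 1)) ℝ)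
    (α : Param m) : Matrix (ParamIdx m) (ParamIdx m) ℝ :=
  pinv (fisherInfo N Sθ α)

/-! ### The closed form -/

/-- `ψ(l, k) = (1 - δ_{kl}/2) vec((E_kl + E_lk) Σ_θ̃ L̃ + L̃ Σ_θ̃ (E_kl + E_lk))`,
with `E_kl = e_k e_lᵀ`. -/
noncomputable def psi {m : ℕ} (Sθ : Matrix (Fin (m + 1)) (Fin (m + 1)) ℝ) (α : Param m)
    (l k : Fin m) : Fin m × Fin m → ℝ :=
  (1 - (1 / 2 : ℝ) * (if k = l then 1 else 0)) •
    Matrix.vec ((Matrix.single k l (1 : ℝ) + Matrix.single l k 1) * redStateCov Sθ * redLap α +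
      redLap α * redStateCov Sθ * (Matrix.single k l (1 : ℝ) + Matrix.single l k 1))

/-- `Ψ`: the columns `ψ(l, k)`, `l ≤ k`, and the last column `vec(U† (U†)ᵀ)`. -/
noncomputable def Psi {m : ℕ} (Sθ : Matrix (Fin (m + 1)) (Fin (m + 1)) ℝ) (α : Param m) :
    Matrix (Fin m × Fin m) (ParamIdx m) ℝ :=
  Matrix.of fun ij r => Sum.elim (fun p : VechIdx m => psi Sθ α p.1.2 p.1.1 ij)
    (fun _ => Matrix.vec (noiseShape m) ij) r

/-- `Q`, the Kronecker square of the inverse of the observation covariance. -/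
noncomputable def matQ {m : ℕ} (Sθ : Matrix (Fin (m + 1)) (Fin (m + 1)) ℝ) (α : Param m) :
    Matrix (Fin m × Fin m) (Fin m × Fin m) ℝ :=
  (obsCov Sθ α)⁻¹ ⊗ₖ (obsCov Sθ α)⁻¹

/-! ### Estimators -/

/-- Estimators of `α` from the data. -/
abbrev Estimator (m N : ℕ) : Type := (Fin N → EuclideanSpace ℝ (Fin m)) → Param m

/-- The mean `E_β[α̂]` of an estimator when the true parameter is `β`. -/
noncomputable def estMean {m N : ℕ} (Sθ : Matrix (Fin (m + 1)) (Fin (m + 1)) ℝ)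
    (est : Estimator m N) (β : Param m) : Param m :=
  fun r => ∫ x, est x r ∂(dataLaw N Sθ β)

/-- The estimator is unbiased at every parameter of `K`. -/
def IsUnbiasedOn {m N : ℕ} (Sθ : Matrix (Fin (m + 1)) (Fin (m + 1)) ℝ)
    (est : Estimator m N) (K : Set (Param m)) : Prop :=
  ∀ β ∈ K, (∀ r, Integrable (fun x => est x r) (dataLaw N Sθ β)) ∧ estMean Sθ est β = β

/-- First-order unbiasedness at `α` in the directions that the data inform about: the mean,
as a function on `K`, has a derivative at `α` that is the identity on the range of `J(α)`. -/
def IsUnbiasedToFirstOrder {m N : ℕ} (Sθ : Matrix (Fin (m + 1)) (Fin (m + 1)) ℝ)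
    (est : Estimator m N) (K : Set (Param m)) (α : Param m) : Prop :=
  ∃ G : Param m →L[ℝ] Param m, HasFDerivWithinAt (estMean Sθ est) G K α ∧
    ∀ v : Param m, G (fisherInfo N Sθ α *ᵥ v) = fisherInfo N Sθ α *ᵥ v

/-- The mean-squared-error matrix `E_α[(α̂ - α)(α̂ - α)ᵀ]`. -/
noncomputable def mseMatrix {m N : ℕ} (Sθ : Matrix (Fin (m + 1)) (Fin (m + 1)) ℝ)
    (est : Estimator m N) (α : Param m) : Matrix (ParamIdx m) (ParamIdx m) ℝ :=
  Matrix.of fun r s => ∫ x, (est x r - α r) * (est x s - α s) ∂(dataLaw N Sθ α)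

end GraphCRB

/-! Writing C for `obsCov`, the log-likelihood of N independent N(0, C(β)) samples is linear in a
fixed statistic: log f(x; β) = ⟨T(x), η(β)⟩, where η(β) = (-(N/2) log((2π)^m det C), C⁻¹) is
`natParam` and T is `suffStat`. Differentiating log det and the inverse gives the score in direction
v, with D the derivative of C along v: ½ ∑ₙ xₙᵀC⁻¹DC⁻¹xₙ - (N/2) tr(C⁻¹D).

Fisher information: diagonalising a symmetric form turns it into ∑ λᵢ xᵢ² with independent standard
normal xᵢ, so Var(xᵀAx) = 2 tr(ACAC) for x ~ N(0, C). With A = C⁻¹DC⁻¹ the score has mean zero and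
second moment (N/2) tr(C⁻¹DC⁻¹D). Polarisation gives the mixed moments, and the vec/Kronecker
identity rewrites the trace as an entry of ΨᵀQΨ.

Bound: E_β[α̂] = E_α[α̂ exp⟨T, η(β) - η(α)⟩]. Since ‖T‖ has an exponential moment (Fernique), this
may be differentiated under the integral (`hasFDerivAt_integral_mul_exp`), and its derivative is the
matrix G of cross-moments of α̂ with the scores. Unique differentiability within K identifies G with
the derivative in the unbiasedness hypothesis, so GJ = J. Positivity of the Gram matrix of errors
and scores then gives MSE ⪰ J† (`posSemidef_sub_pinv_of_mul_eq`), with no invertibility of J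
required. -/

namespace GraphCRB

/-! ### Product and image measures with densities -/

section Densities

/-- A product of measures with integrable densities has the product density. -/
theorem pi_withDensity_ofReal {ι : Type*} [Fintype ι] {X : ι → Type*}
    [∀ i, MeasurableSpace (X i)] (μ : ∀ i, Measure (X i)) [∀ i, SigmaFinite (μ i)]
    {f : ∀ i, X i → ℝ} (hf0 : ∀ i x, 0 ≤ f i x) (hf : ∀ i, Integrable (f i) (μ i)) :
    Measure.pi (fun i => (μ i).withDensity fun x => ENNReal.ofReal (f i x)) =
      (Measure.pi μ).withDensity fun x => ENNReal.ofReal (∏ i, f i (x i)) := by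
  have hfin : ∀ i, IsFiniteMeasure ((μ i).withDensity fun x => ENNReal.ofReal (f i x)) :=
    fun i => isFiniteMeasure_withDensity_ofReal (hf i).2
  -- It suffices to compare the measures of boxes, where Fubini factors the integral of the product.
  refine Measure.pi_eq fun s hs => ?_
  rw [withDensity_apply _ (MeasurableSet.univ_pi hs), Measure.restrict_pi_pi]
  have hint : Integrable (fun x : (∀ i, X i) => ∏ i, f i (x i))
      (Measure.pi fun i => (μ i).restrict (s i)) :=
    Integrable.fintype_prod_dep fun i => (hf i).restrict
  rw [← ofReal_integral_eq_lintegral_ofReal hint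
    (Filter.Eventually.of_forall fun x => Finset.prod_nonneg fun i _ => hf0 i _),
    integral_fintype_prod_eq_prod, ENNReal.ofReal_prod_of_nonneg
    fun i _ => integral_nonneg fun x => hf0 i x]
  refine Finset.prod_congr rfl fun i _ => ?_
  rw [withDensity_apply _ (hs i), ofReal_integral_eq_lintegral_ofReal (hf i).restrict
    (Filter.Eventually.of_forall fun x => hf0 i x)]

theorem map_withDensity_measurableEquiv {X Y : Type*} [MeasurableSpace X] [MeasurableSpace Y]
    (e : X ≃ᵐ Y) (μ : Measure X) (f : X → ENNReal) :
    (μ.withDensity f).map e = (μ.map e).withDensity (f ∘ e.symm) := by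
  ext s hs
  rw [Measure.map_apply e.measurable hs, withDensity_apply _ (e.measurable hs),
    withDensity_apply _ hs, e.restrict_map, lintegral_map_equiv]
  simp

end Densities

/-! ### Gaussian densities -/

section GaussianDensity

variable {ι : Type*} [Fintype ι]

/-- The standard Gaussian is a product of one-dimensional ones, carried to Euclidean space by a
volume-preserving relabelling. -/
theorem stdGaussian_eq_withDensity :
    stdGaussian (EuclideanSpace ℝ ι) = volume.withDensity fun x : EuclideanSpace ℝ ι =>
      ENNReal.ofReal ((Real.sqrt ((2 * Real.pi) ^ Fintype.card ι))⁻¹ *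
        Real.exp (-(x.ofLp ⬝ᵥ x.ofLp) / 2)) := by
  have h1 : Measure.pi (fun _ : ι => gaussianReal 0 1) = (volume : Measure (ι → ℝ)).withDensity
      fun x => ENNReal.ofReal (∏ i, gaussianPDFReal 0 1 (x i)) := by
    rw [volume_pi, ← pi_withDensity_ofReal (fun _ : ι => (volume : Measure ℝ))
      (fun _ x => gaussianPDFReal_nonneg 0 1 x) (fun _ => integrable_gaussianPDFReal 0 1)]
    congr 1
    funext i
    rw [gaussianReal_of_var_ne_zero _ one_ne_zero]
    rfl
  rw [← map_pi_eq_stdGaussian, h1]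
  have h2 := map_withDensity_measurableEquiv (MeasurableEquiv.toLp 2 (ι → ℝ)) volume
    fun x => ENNReal.ofReal (∏ i, gaussianPDFReal 0 1 (x i))
  rw [MeasurableEquiv.coe_toLp, (PiLp.volume_preserving_toLp ι).map_eq] at h2
  rw [h2]
  congr 1
  funext x
  simp only [Function.comp_apply, MeasurableEquiv.coe_toLp_symm, gaussianPDFReal,
    Finset.prod_mul_distrib, ← Real.exp_sum, NNReal.coe_one, mul_one, sub_zero,
    Finset.prod_const, Finset.card_univ, dotProduct]
  congr 3
  · rw [inv_pow, Real.sqrt_eq_rpow, Real.sqrt_eq_rpow, ← Real.rpow_natCast, ← Real.rpow_natCast,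
      ← Real.rpow_mul (by positivity), ← Real.rpow_mul (by positivity), mul_comm (1 / 2 : ℝ)]
  · rw [← Finset.sum_div, Finset.sum_neg_distrib]
    simp [sq]

variable [DecidableEq ι]

/-- Change of variables along the invertible square root B of S: the Jacobian factor is |det B|⁻¹ =
(det S)^(-1/2), and |B⁻¹x|² = xᵀS⁻¹x. -/
theorem multivariateGaussian_eq_withDensity {S : Matrix ι ι ℝ} (hS : S.PosDef) :
    multivariateGaussian 0 S = volume.withDensity fun x : EuclideanSpace ℝ ι =>
      ENNReal.ofReal ((Real.sqrt ((2 * Real.pi) ^ Fintype.card ι * S.det))⁻¹ *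
        Real.exp (-(x.ofLp ⬝ᵥ S⁻¹ *ᵥ x.ofLp) / 2)) := by
  open scoped MatrixOrder in
  obtain ⟨B, hB, hBt, hBdef⟩ : ∃ B : Matrix ι ι ℝ, B * B = S ∧ Bᵀ = B ∧ CFC.sqrt S = B :=
    ⟨CFC.sqrt S, CFC.sqrt_mul_sqrt_self S hS.posSemidef.nonneg, by
      have h := (CFC.sqrt_nonneg S).isSelfAdjoint.star_eq
      rwa [star_eq_conjTranspose, conjTranspose_eq_transpose_of_trivial] at h, rfl⟩
  have hdet : B.det * B.det = S.det := by rw [← det_mul, hB]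
  have hBu : IsUnit B.det := by
    rw [isUnit_iff_ne_zero]
    intro h
    rw [h, mul_zero] at hdet
    exact hS.det_pos.ne hdet
  let e : EuclideanSpace ℝ ι ≃L[ℝ] EuclideanSpace ℝ ι :=
    ContinuousLinearEquiv.equivOfInverse (toEuclideanCLM (𝕜 := ℝ) B) (toEuclideanCLM (𝕜 := ℝ) B⁻¹)
      (fun x => by
        rw [← mul_apply_eq_comp, ← map_mul, nonsing_inv_mul _ hBu]; simp)
      (fun x => by
        rw [← mul_apply_eq_comp, ← map_mul, mul_nonsing_inv _ hBu]; simp)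
  have hdet' : LinearMap.det (toEuclideanCLM (𝕜 := ℝ) B : EuclideanSpace ℝ ι →ₗ[ℝ] _) = B.det := by
    rw [coe_toEuclideanCLM_eq_toEuclideanLin, toEuclideanLin, toLpLin_eq_toLin, LinearMap.det_toLin]
  have hvol : (volume : Measure (EuclideanSpace ℝ ι)).map e.toHomeomorph.toMeasurableEquiv =
      ENNReal.ofReal |(B.det)⁻¹| • volume := by
    have := Measure.map_linearMap_addHaar_eq_smul_addHaar (volume : Measure (EuclideanSpace ℝ ι))
      (f := (toEuclideanCLM (𝕜 := ℝ) B : EuclideanSpace ℝ ι →ₗ[ℝ] _)) (by rw [hdet']; exact hBu.ne_zero)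
    rw [hdet'] at this
    exact this
  have hmap : multivariateGaussian 0 S =
      (stdGaussian (EuclideanSpace ℝ ι)).map e.toHomeomorph.toMeasurableEquiv := by
    rw [multivariateGaussian, hBdef]
    simp only [zero_add]
    rfl
  rw [hmap, stdGaussian_eq_withDensity, map_withDensity_measurableEquiv, hvol,
    withDensity_smul_measure, ← withDensity_smul' _ _ ENNReal.ofReal_ne_top]
  congr 1
  funext x
  have hx : e.toHomeomorph.toMeasurableEquiv.symm x = toEuclideanCLM (𝕜 := ℝ) B⁻¹ x := rfl
  have hq : (B⁻¹ *ᵥ x.ofLp) ⬝ᵥ (B⁻¹ *ᵥ x.ofLp) = x.ofLp ⬝ᵥ S⁻¹ *ᵥ x.ofLp := by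
    rw [← hB, Matrix.mul_inv_rev, ← mulVec_mulVec, dotProduct_mulVec x.ofLp, ← mulVec_transpose,
      transpose_nonsing_inv, hBt]
  simp only [Pi.smul_apply, Function.comp_apply, hx, ofLp_toEuclideanCLM, hq, smul_eq_mul]
  rw [← ENNReal.ofReal_mul (abs_nonneg _), ← mul_assoc]
  congr 2
  rw [Real.sqrt_mul (by positivity), mul_inv, ← hdet, Real.sqrt_mul_self_eq_abs, abs_inv, mul_comm]

end GaussianDensity

/-! ### The law of the observations -/

section ObservationLaw

variable {m : ℕ} {Sθ : Matrix (Fin (m + 1)) (Fin (m + 1)) ℝ}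

/-- Deleting the first row is a left inverse of U, so U can be cancelled on the left of U U†U = U.
-/
theorem pinv_matU_mul_matU (m : ℕ) : pinv (matU m) * matU m = 1 := by
  obtain ⟨V, hV⟩ : ∃ V : Matrix (Fin m) (Fin (m + 1)) ℝ, V * matU m = 1 :=
    ⟨Matrix.of fun i j => if j = i.succ then 1 else 0, by
      ext i j
      simp [mul_apply, matU, one_apply]⟩
  calc pinv (matU m) * matU m
      = V * matU m * (pinv (matU m) * matU m) := by rw [hV, Matrix.one_mul]
    _ = V * (matU m * pinv (matU m) * matU m) := by simp only [Matrix.mul_assoc]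
    _ = 1 := by rw [(isMoorePenrose_pinv _).mul_mul_self, hV]

theorem redLap_transpose (α : Param m) : (redLap α)ᵀ = redLap α := by
  ext i j
  simp [redLap, max_comm, min_comm]

/-- Characteristic functions are used because `Sθ` may be singular and σ² may vanish, so θ and w
need not have densities. Moving the linear maps to the other side of the inner product splits the
integral into the two independent Gaussian factors. -/
theorem charFun_snapshotLaw (hS : Sθ.PosSemidef) {α : Param m} (h0 : 0 ≤ noiseVar α)
    (t : EuclideanSpace ℝ (Fin m)) :
    charFun (snapshotLaw Sθ α) t = Complex.exp (-((t.ofLp ⬝ᵥ obsCov Sθ α *ᵥ t.ofLp : ℝ) : ℂ) / 2) := by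
  have h1 : (noiseVar α • (1 : Matrix (Fin (m + 1)) (Fin (m + 1)) ℝ)).PosSemidef :=
    PosSemidef.one.smul h0
  set B : Matrix (Fin m) (Fin (m + 1)) ℝ := redLap α * (matU m)ᵀ with hB
  have hpush : ∀ z : EuclideanSpace ℝ (Fin (m + 1)) × EuclideanSpace ℝ (Fin (m + 1)),
      inner ℝ (WithLp.toLp 2 (pinv (matU m) *ᵥ
        ((matU m * redLap α * (matU m)ᵀ) *ᵥ z.1.ofLp + z.2.ofLp))) t =
      inner ℝ z.1 (WithLp.toLp 2 (Bᵀ *ᵥ t.ofLp)) +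
        inner ℝ z.2 (WithLp.toLp 2 ((pinv (matU m))ᵀ *ᵥ t.ofLp)) := by
    intro z
    have : pinv (matU m) * (matU m * redLap α * (matU m)ᵀ) = B := by
      rw [Matrix.mul_assoc (matU m), ← Matrix.mul_assoc, pinv_matU_mul_matU, Matrix.one_mul]
    simp only [EuclideanSpace.inner_eq_star_dotProduct, star_trivial, mulVec_add, mulVec_mulVec,
      this, dotProduct_add, mulVec_transpose, dotProduct_mulVec]
  rw [charFun_apply, snapshotLaw, integral_map (by fun_prop) (by fun_prop)]
  simp_rw [hpush, Complex.ofReal_add, add_mul, Complex.exp_add]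
  rw [integral_prod_mul (fun x => Complex.exp (((inner ℝ x (WithLp.toLp 2 (Bᵀ *ᵥ t.ofLp)) : ℝ) : ℂ)
    * Complex.I)) (fun x => Complex.exp (((inner ℝ x (WithLp.toLp 2
      ((pinv (matU m))ᵀ *ᵥ t.ofLp)) : ℝ) : ℂ) * Complex.I)), ← charFun_apply, ← charFun_apply,
    charFun_multivariateGaussian hS, charFun_multivariateGaussian h1, ← Complex.exp_add]
  have hq : ∀ (A : Matrix (Fin m) (Fin (m + 1)) ℝ) (R : Matrix (Fin (m + 1)) (Fin (m + 1)) ℝ),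
      (Aᵀ *ᵥ t.ofLp) ⬝ᵥ R *ᵥ (Aᵀ *ᵥ t.ofLp) = t.ofLp ⬝ᵥ (A * R * Aᵀ) *ᵥ t.ofLp := by
    intro A R
    rw [← mulVec_mulVec, dotProduct_mulVec _ (A * R), ← vecMul_vecMul, ← dotProduct_mulVec,
      mulVec_transpose]
  have hC : obsCov Sθ α = B * Sθ * Bᵀ + pinv (matU m) *
      (noiseVar α • (1 : Matrix (Fin (m + 1)) (Fin (m + 1)) ℝ)) * (pinv (matU m))ᵀ := by
    rw [obsCov, redStateCov, noiseShape, hB, transpose_mul, transpose_transpose, redLap_transpose]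
    simp only [Matrix.mul_assoc, Matrix.mul_smul, Matrix.smul_mul, Matrix.one_mul]
  rw [hC, add_mulVec, dotProduct_add, ← hq, ← hq]
  congr 1
  simp only [inner_zero_right]
  push_cast
  ring

theorem snapshotLaw_eq (hS : Sθ.PosSemidef) {α : Param m} (hα : α ∈ paramSpace Sθ) :
    snapshotLaw Sθ α = multivariateGaussian 0 (obsCov Sθ α) := by
  have : IsProbabilityMeasure (snapshotLaw Sθ α) :=
    Measure.isProbabilityMeasure_map (Measurable.aemeasurable (by fun_prop))
  refine Measure.ext_of_charFun (funext fun t => ?_)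
  rw [charFun_snapshotLaw hS hα.1, charFun_multivariateGaussian hα.2.posSemidef]
  congr 1
  simp only [inner_zero_right]
  push_cast
  ring

theorem dataLaw_eq (hS : Sθ.PosSemidef) (N : ℕ) {α : Param m} (hα : α ∈ paramSpace Sθ) :
    dataLaw N Sθ α = Measure.pi fun _ => multivariateGaussian 0 (obsCov Sθ α) := by
  rw [dataLaw, snapshotLaw_eq hS hα]

theorem dataLaw_eq_withDensity (hS : Sθ.PosSemidef) (N : ℕ) {α : Param m}
    (hα : α ∈ paramSpace Sθ) :
    dataLaw N Sθ α = volume.withDensity fun x => ENNReal.ofReal (dataDensity Sθ α x) := by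
  have h1 := multivariateGaussian_eq_withDensity hα.2
  rw [Fintype.card_fin] at h1
  -- The density is integrable because the measure it defines is the Gaussian law, which is finite.
  have hint : Integrable (fun x : EuclideanSpace ℝ (Fin m) =>
      (Real.sqrt ((2 * Real.pi) ^ m * (obsCov Sθ α).det))⁻¹ *
        Real.exp (-(x.ofLp ⬝ᵥ (obsCov Sθ α)⁻¹ *ᵥ x.ofLp) / 2)) volume := by
    refine ⟨Continuous.aestronglyMeasurable (by fun_prop), ?_⟩
    rw [hasFiniteIntegral_iff_ofReal (Filter.Eventually.of_forall fun x => by positivity),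
      ← setLIntegral_univ, ← withDensity_apply _ MeasurableSet.univ, ← h1]
    exact measure_lt_top _ _
  rw [dataLaw_eq hS N hα, h1, volume_pi]
  exact pi_withDensity_ofReal (fun _ : Fin N => (volume : Measure (EuclideanSpace ℝ (Fin m))))
    (fun _ x => by positivity) (fun _ => hint)

end ObservationLaw

/-! ### Quadratic forms in Gaussian vectors -/

section QuadraticForms

theorem integrable_pow_gaussianReal (n : ℕ) : Integrable (fun x : ℝ => x ^ n) (gaussianReal 0 1) :=
  integrable_pow_of_mem_interior_integrableExpSet (X := fun x : ℝ => x) (by simp) n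

theorem memLp_sq_gaussianReal : MemLp (fun x : ℝ => x ^ 2) 2 (gaussianReal 0 1) := by
  rw [memLp_two_iff_integrable_sq (by fun_prop)]
  simpa only [← pow_mul] using integrable_pow_gaussianReal (2 * 2)

theorem integral_sq_gaussianReal : ∫ x : ℝ, x ^ 2 ∂gaussianReal 0 1 = 1 := by
  have h := variance_fun_id_gaussianReal (μ := 0) (v := 1)
  rw [variance_eq_integral measurable_id'.aemeasurable] at h
  simpa using h

theorem integral_pow_four_gaussianReal : ∫ x : ℝ, x ^ 4 ∂gaussianReal 0 1 = 3 := by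
  have h : iteratedDeriv 4 (mgf (fun x : ℝ => x) (gaussianReal 0 1)) 0 =
      ∫ x : ℝ, x ^ 4 ∂gaussianReal 0 1 := by
    rw [iteratedDeriv_mgf_zero (by simp)]
    rfl
  rw [← h, mgf_fun_id_gaussianReal]
  -- Differentiating p(t) exp(t²/2) sends p to p' + pX; four rounds from p = 1, evaluated at 0, give
  -- 3.
  have key : ∀ p : Polynomial ℝ, deriv (fun t => p.eval t * Real.exp (t ^ 2 / 2)) =
      fun t => (p.derivative + p * Polynomial.X).eval t * Real.exp (t ^ 2 / 2) := by
    intro p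
    funext t
    have h2 : HasDerivAt (fun t : ℝ => Real.exp (t ^ 2 / 2)) (Real.exp (t ^ 2 / 2) * t) t := by
      refine HasDerivAt.exp ?_
      simpa using (hasDerivAt_pow 2 t).div_const 2
    refine ((p.hasDerivAt t).fun_mul h2).deriv.trans ?_
    simp only [Polynomial.eval_add, Polynomial.eval_mul, Polynomial.eval_X]
    ring
  have e0 : (fun t : ℝ => Real.exp (0 * t + ((1 : NNReal) : ℝ) * t ^ 2 / 2)) =
      fun t => (1 : Polynomial ℝ).eval t * Real.exp (t ^ 2 / 2) := by
    funext t; simp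
  rw [iteratedDeriv_eq_iterate, e0]
  simp only [Function.iterate_succ, Function.iterate_zero, Function.comp_apply, id, key]
  simp
  norm_num

theorem variance_sq_gaussianReal : Var[fun x : ℝ => x ^ 2; gaussianReal 0 1] = 2 := by
  rw [variance_eq_sub memLp_sq_gaussianReal]
  simp only [Pi.pow_apply, ← pow_mul]
  rw [integral_pow_four_gaussianReal, integral_sq_gaussianReal]
  norm_num

variable {ι : Type*} [Fintype ι]

/-- The quadratic form `xᵀ A x`. -/
def quadForm (A : Matrix ι ι ℝ) (x : EuclideanSpace ℝ ι) : ℝ := x.ofLp ⬝ᵥ A *ᵥ x.ofLp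

theorem continuous_quadForm (A : Matrix ι ι ℝ) : Continuous (quadForm A) := by
  unfold quadForm
  fun_prop

variable [DecidableEq ι]

theorem trace_mul_self_eq_sum_eigenvalues_sq {M : Matrix ι ι ℝ} (hM : M.IsHermitian) :
    (M * M).trace = ∑ i, hM.eigenvalues i ^ 2 := by
  have h := hM.spectral_theorem
  have hV := Unitary.coe_star_mul_self hM.eigenvectorUnitary
  set V : Matrix ι ι ℝ := (hM.eigenvectorUnitary : Matrix ι ι ℝ) with hVdef
  have h' : M = V * diagonal hM.eigenvalues * star V := by
    simpa [Unitary.conjStarAlgAut_apply] using h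
  have h2 : M * M = V * (diagonal hM.eigenvalues * diagonal hM.eigenvalues) * star V := by
    conv_lhs => rw [h']
    calc _ = V * diagonal hM.eigenvalues * (star V * V) * diagonal hM.eigenvalues * star V := by
          simp only [Matrix.mul_assoc]
      _ = _ := by rw [hV, Matrix.mul_one, Matrix.mul_assoc V]
  rw [h2, trace_mul_cycle, hV, Matrix.one_mul, diagonal_mul_diagonal, trace_diagonal]
  simp [sq]

theorem quadForm_sum_eigenvectorBasis {M : Matrix ι ι ℝ} (hM : M.IsHermitian) (x : ι → ℝ) :
    quadForm M (∑ i, x i • hM.eigenvectorBasis i) = ∑ i, hM.eigenvalues i * x i ^ 2 := by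
  have h1 : toEuclideanCLM (𝕜 := ℝ) M (∑ i, x i • hM.eigenvectorBasis i) =
      ∑ i, (x i * hM.eigenvalues i) • hM.eigenvectorBasis i := by
    rw [map_sum]
    refine Finset.sum_congr rfl fun i _ => ?_
    rw [map_smul, mul_smul]
    congr 1
    exact (WithLp.ofLp_injective 2) (hM.mulVec_eigenvectorBasis i)
  rw [quadForm, ← inner_toEuclideanCLM, h1, hM.eigenvectorBasis.orthonormal.inner_sum]
  refine Finset.sum_congr rfl fun i _ => ?_
  simp only [conj_trivial]
  ring

/-- The standard Gaussian has independent standard coordinates in every orthonormal basis. In an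
eigenbasis of M the form is ∑ λᵢ xᵢ², with mean ∑ λᵢ and variance 2 ∑ λᵢ². -/
theorem quadForm_stdGaussian {M : Matrix ι ι ℝ} (hM : M.IsHermitian) :
    MemLp (quadForm M) 2 (stdGaussian (EuclideanSpace ℝ ι)) ∧
    ∫ x, quadForm M x ∂(stdGaussian (EuclideanSpace ℝ ι)) = M.trace ∧
    Var[quadForm M; stdGaussian (EuclideanSpace ℝ ι)] = 2 * (M * M).trace := by
  have hmeas : Measurable fun x : ι → ℝ => ∑ i, x i • hM.eigenvectorBasis i := by fun_prop
  have hq : Measurable (quadForm M) := (continuous_quadForm M).measurable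
  have hcomp : quadForm M ∘ (fun x : ι → ℝ => ∑ i, x i • hM.eigenvectorBasis i) =
      ∑ i, fun x : ι → ℝ => hM.eigenvalues i * x i ^ 2 := by
    funext x
    simp [quadForm_sum_eigenvectorBasis]
  have hL : ∀ i, MemLp (fun t : ℝ => hM.eigenvalues i * t ^ 2) 2 (gaussianReal 0 1) :=
    fun i => memLp_sq_gaussianReal.const_mul _
  rw [stdGaussian_eq_map_pi_orthonormalBasis hM.eigenvectorBasis]
  refine ⟨?_, ?_, ?_⟩
  · rw [memLp_map_measure_iff hq.aestronglyMeasurable hmeas.aemeasurable, hcomp]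
    exact memLp_finsetSum' _ fun i _ =>
      (hL i).comp_measurePreserving (measurePreserving_eval (fun _ : ι => gaussianReal 0 1) i)
  · rw [integral_map hmeas.aemeasurable hq.aestronglyMeasurable]
    simp_rw [quadForm_sum_eigenvectorBasis]
    rw [integral_finsetSum _ fun i _ => integrable_comp_eval
      (μ := fun _ : ι => gaussianReal 0 1) ((hL i).integrable one_le_two)]
    rw [hM.trace_eq_sum_eigenvalues]
    refine Finset.sum_congr rfl fun i _ => ?_
    rw [integral_comp_eval (μ := fun _ : ι => gaussianReal 0 1)
      (f := fun t : ℝ => hM.eigenvalues i * t ^ 2) (hL i).1, integral_const_mul,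
      integral_sq_gaussianReal]
    simp
  · rw [variance_map hq.aemeasurable hmeas.aemeasurable, hcomp, variance_sum_pi hL,
      trace_mul_self_eq_sum_eigenvalues_sq hM, Finset.mul_sum]
    refine Finset.sum_congr rfl fun i _ => ?_
    rw [variance_const_mul, variance_sq_gaussianReal]
    ring

/-- With B the square root of C, the form A at Bz is the form BAB at the standard vector z;
cyclicity of the trace restores C = B². -/
theorem quadForm_multivariateGaussian {A C : Matrix ι ι ℝ} (hA : A.IsHermitian)
    (hC : C.PosSemidef) :
    MemLp (quadForm A) 2 (multivariateGaussian 0 C) ∧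
    ∫ x, quadForm A x ∂(multivariateGaussian 0 C) = (A * C).trace ∧
    Var[quadForm A; multivariateGaussian 0 C] = 2 * (A * C * (A * C)).trace := by
  open scoped MatrixOrder in
  obtain ⟨B, hB, hBt, hBdef⟩ : ∃ B : Matrix ι ι ℝ, B * B = C ∧ Bᵀ = B ∧ CFC.sqrt C = B :=
    ⟨CFC.sqrt C, CFC.sqrt_mul_sqrt_self C hC.nonneg, by
      have h := (CFC.sqrt_nonneg C).isSelfAdjoint.star_eq
      rwa [star_eq_conjTranspose, conjTranspose_eq_transpose_of_trivial] at h, rfl⟩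
  have hM : (B * A * B).IsHermitian := by
    rw [IsHermitian, conjTranspose_eq_transpose_of_trivial] at hA ⊢
    rw [transpose_mul, transpose_mul, hA, hBt, Matrix.mul_assoc]
  obtain ⟨h1, h2, h3⟩ := quadForm_stdGaussian hM
  have hcomp : quadForm A ∘ (fun x => toEuclideanCLM (𝕜 := ℝ) B x) = quadForm (B * A * B) := by
    funext x
    simp only [Function.comp_apply, quadForm, ofLp_toEuclideanCLM]
    rw [← mulVec_mulVec, dotProduct_mulVec x.ofLp (B * A), ← vecMul_vecMul, ← dotProduct_mulVec,
      ← mulVec_transpose B, hBt]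
  have hmeas : Measurable fun x => toEuclideanCLM (𝕜 := ℝ) B x := by fun_prop
  have hq : Measurable (quadForm A) := (continuous_quadForm A).measurable
  have hmap : multivariateGaussian 0 C =
      (stdGaussian (EuclideanSpace ℝ ι)).map fun x => toEuclideanCLM (𝕜 := ℝ) B x := by
    rw [multivariateGaussian, hBdef]
    simp only [zero_add]
  rw [hmap]
  refine ⟨?_, ?_, ?_⟩
  · rw [memLp_map_measure_iff hq.aestronglyMeasurable hmeas.aemeasurable, hcomp]
    exact h1
  · rw [integral_map hmeas.aemeasurable hq.aestronglyMeasurable]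
    have : (fun x => quadForm A (toEuclideanCLM (𝕜 := ℝ) B x)) = quadForm (B * A * B) := hcomp
    rw [this, h2, trace_mul_cycle, ← hB, trace_mul_comm A, Matrix.mul_assoc]
  · rw [variance_map hq.aemeasurable hmeas.aemeasurable, hcomp, h3, ← hB]
    congr 1
    rw [Matrix.mul_assoc B A B, Matrix.mul_assoc, trace_mul_comm B]
    simp only [Matrix.mul_assoc]

/-- Moments of a sum of quadratic forms over independent samples. -/
theorem sum_quadForm_pi {A C : Matrix ι ι ℝ} (hA : A.IsHermitian) (hC : C.PosSemidef) (N : ℕ) :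
    MemLp (fun x : Fin N → EuclideanSpace ℝ ι => ∑ n, quadForm A (x n)) 2
      (Measure.pi fun _ => multivariateGaussian 0 C) ∧
    ∫ x, ∑ n : Fin N, quadForm A (x n) ∂(Measure.pi fun _ => multivariateGaussian 0 C) =
      N * (A * C).trace ∧
    Var[fun x : Fin N → EuclideanSpace ℝ ι => ∑ n, quadForm A (x n);
      Measure.pi fun _ => multivariateGaussian 0 C] = N * (2 * (A * C * (A * C)).trace) := by
  obtain ⟨h1, h2, h3⟩ := quadForm_multivariateGaussian hA hC
  refine ⟨?_, ?_, ?_⟩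
  · exact memLp_finsetSum _ fun n _ => h1.comp_measurePreserving
      (measurePreserving_eval (fun _ : Fin N => multivariateGaussian 0 C) n)
  · rw [integral_finsetSum _ fun i _ => integrable_comp_eval
      (μ := fun _ : Fin N => multivariateGaussian 0 C) (h1.integrable one_le_two)]
    simp [integral_comp_eval (μ := fun _ : Fin N => multivariateGaussian 0 C) h1.1, h2]
  · have h := variance_sum_pi (μ := fun _ : Fin N => multivariateGaussian 0 C)
      (X := fun _ => quadForm A) fun _ => h1
    simp only [h3, Finset.sum_const, Finset.card_univ, Fintype.card_fin, nsmul_eq_mul] at h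
    rw [← h]
    congr 1
    funext x
    simp

end QuadraticForms

/-! ### Differentiation in exponential families -/

section ExponentialFamily

variable {X E : Type*} [MeasurableSpace X] {μ : Measure X} [NormedAddCommGroup E] [NormedSpace ℝ E]
  {T : X → StrongDual ℝ E} {ε : ℝ}

/-- Halving the exponent buys square integrability, so that this factor can be paired with an L²
statistic. -/
theorem memLp_exp_norm_of_integrable (hT : AEStronglyMeasurable T μ)
    (hexp : Integrable (fun x => Real.exp (ε * ‖T x‖)) μ) :
    MemLp (fun x => Real.exp (ε / 2 * ‖T x‖)) 2 μ := by
  rw [memLp_two_iff_integrable_sq (Real.continuous_exp.comp_aestronglyMeasurable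
    (hT.norm.const_mul _))]
  refine hexp.congr (Filter.Eventually.of_forall fun x => ?_)
  simp only [← Real.exp_nat_mul]
  congr 1
  push_cast
  ring

/-- Half of the available ε/2 absorbs the linear factor y, the other half absorbs the exponential.
-/
theorem norm_mul_exp_le (hε : 0 < ε) {r : ℝ} (hr : r ≤ ε / 4) {y : ℝ} (hy : 0 ≤ y) :
    y * Real.exp (r * y) ≤ 4 / ε * Real.exp (ε / 2 * y) := by
  have h1 : ε / 4 * y ≤ Real.exp (ε / 4 * y) := by
    linarith [Real.add_one_le_exp (ε / 4 * y)]
  calc y * Real.exp (r * y) = 4 / ε * ((ε / 4 * y) * Real.exp (r * y)) := by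
        field_simp
    _ ≤ 4 / ε * (Real.exp (ε / 4 * y) * Real.exp (ε / 4 * y)) := by gcongr
    _ = 4 / ε * Real.exp (ε / 2 * y) := by
        rw [← Real.exp_add]
        congr 2
        ring

theorem memLp_of_integrable_exp_norm (hT : AEStronglyMeasurable T μ) (hε : 0 < ε)
    (hexp : Integrable (fun x => Real.exp (ε * ‖T x‖)) μ) : MemLp T 2 μ := by
  refine ((memLp_exp_norm_of_integrable hT hexp).const_mul (4 / ε)).mono hT
    (Filter.Eventually.of_forall fun x => ?_)
  have h := norm_mul_exp_le hε (r := 0) (by positivity) (norm_nonneg (T x))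
  rw [zero_mul, Real.exp_zero, mul_one] at h
  exact h.trans (Real.le_norm_self _)

/-- The mean of a square integrable statistic in an exponential family, as a function of the
natural parameter, is differentiable at the base point. -/
theorem hasFDerivAt_integral_mul_exp [IsFiniteMeasure μ] (hT : AEStronglyMeasurable T μ)
    (hε : 0 < ε) (hexp : Integrable (fun x => Real.exp (ε * ‖T x‖)) μ)
    {h : X → ℝ} (hh : MemLp h 2 μ) :
    HasFDerivAt (fun θ : E => ∫ x, h x * Real.exp (T x θ) ∂μ) (∫ x, h x • T x ∂μ) 0 := by
  have hTθ : ∀ θ : E, AEStronglyMeasurable (fun x => T x θ) μ := fun θ =>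
    (ContinuousLinearMap.apply ℝ ℝ θ).continuous.comp_aestronglyMeasurable hT
  -- On the ball of radius ε/4 the derivative has norm at most |h| ‖T‖ exp(ε/4 ‖T‖), which is
  -- dominated by a product of two L² functions.
  have key := hasFDerivAt_integral_of_dominated_of_fderiv_le (𝕜 := ℝ) (μ := μ)
    (F := fun (θ : E) x => h x * Real.exp (T x θ))
    (F' := fun (θ : E) x => h x • Real.exp (T x θ) • T x) (x₀ := 0)
    (bound := fun x => ‖h x‖ * (4 / ε * Real.exp (ε / 2 * ‖T x‖)))
    (Metric.ball_mem_nhds 0 (by positivity : 0 < ε / 4))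
    (Filter.Eventually.of_forall fun θ =>
      hh.1.mul (Real.continuous_exp.comp_aestronglyMeasurable (hTθ θ)))
    (by simpa using hh.integrable one_le_two)
    (by simpa using! hh.1.smul hT)
    (Filter.Eventually.of_forall fun x θ hθ => ?_)
    (hh.norm.integrable_mul ((memLp_exp_norm_of_integrable hT hexp).const_mul _))
    (Filter.Eventually.of_forall fun x θ _ => ?_)
  · simpa using key
  · rw [norm_smul, norm_smul, Real.norm_of_nonneg (Real.exp_pos _).le, mul_comm (Real.exp _)]
    have hθ' : ‖θ‖ ≤ ε / 4 := (mem_ball_zero_iff.1 hθ).le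
    refine mul_le_mul_of_nonneg_left
      (le_trans ?_ (norm_mul_exp_le hε hθ' (norm_nonneg (T x)))) (norm_nonneg _)
    gcongr
    rw [mul_comm]
    exact (Real.le_norm_self _).trans ((T x).le_opNorm θ)
  · exact ((T x).hasFDerivAt.exp).const_smul (h x)

end ExponentialFamily

/-! ### The Cramér-Rao inequality for second-moment matrices -/

section CramerRao

variable {X : Type*} [MeasurableSpace X] {μ : Measure X} {ι : Type*} [Fintype ι]

theorem posSemidef_gram_integral {f : ι → X → ℝ} (hf : ∀ i, MemLp (f i) 2 μ) :
    (Matrix.of fun i j => ∫ x, f i x * f j x ∂μ).PosSemidef := by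
  rw [posSemidef_iff_dotProduct_mulVec]
  refine ⟨?_, fun v => ?_⟩
  · ext i j
    simp [mul_comm]
  · have h : star v ⬝ᵥ (Matrix.of fun i j => ∫ x, f i x * f j x ∂μ) *ᵥ v =
        ∫ x, (∑ i, v i * f i x) ^ 2 ∂μ := by
      have h1 : ∀ x, (∑ i, v i * f i x) ^ 2 = ∑ i, ∑ j, v i * ((f i x * f j x) * v j) := by
        intro x
        rw [sq, Finset.sum_mul_sum]
        refine Finset.sum_congr rfl fun i _ => Finset.sum_congr rfl fun j _ => ?_
        ring
      have hint : ∀ i j, Integrable (fun x => v i * ((f i x * f j x) * v j)) μ := fun i j =>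
        (((hf i).integrable_mul (hf j)).mul_const _).const_mul _
      simp_rw [h1]
      rw [integral_finsetSum _ fun i _ => integrable_finsetSum _ fun j _ => hint i j]
      simp only [dotProduct, mulVec, Finset.mul_sum, star_trivial, of_apply]
      refine Finset.sum_congr rfl fun i _ => ?_
      rw [integral_finsetSum _ fun j _ => hint i j]
      refine Finset.sum_congr rfl fun j _ => ?_
      rw [integral_const_mul, integral_mul_const]
    rw [h]
    exact integral_nonneg fun x => sq_nonneg _

theorem IsMoorePenrose.smul {κ : Type*} [Fintype κ] {A : Matrix ι κ ℝ} {B : Matrix κ ι ℝ}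
    (h : IsMoorePenrose A B) {c : ℝ} (hc : c ≠ 0) : IsMoorePenrose (c • A) (c⁻¹ • B) where
  mul_mul_self := by simp [h.mul_mul_self, smul_smul, hc]
  mul_mul_inv := by simp [h.mul_mul_inv, smul_smul, hc]
  symm_left := by simpa [smul_smul, hc] using h.symm_left
  symm_right := by simpa [smul_smul, hc] using h.symm_right

theorem pinv_smul {κ : Type*} [Fintype κ] (A : Matrix ι κ ℝ) {c : ℝ} (hc : c ≠ 0) :
    pinv (c • A) = c⁻¹ • pinv A :=
  (isMoorePenrose_pinv _).unique ((isMoorePenrose_pinv A).smul hc)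

theorem transpose_pinv {A : Matrix ι ι ℝ} (hA : Aᵀ = A) : (pinv A)ᵀ = pinv A := by
  have h := (isMoorePenrose_pinv A).transpose
  rw [hA] at h
  exact h.unique (isMoorePenrose_pinv A)

/-- `E[e eᵀ] - J†` is positive semidefinite as soon as the cross-moments `G = E[e sᵀ]` act as the
identity on the range of `J = E[s sᵀ]`. -/
theorem posSemidef_sub_pinv_of_mul_eq {e s : ι → X → ℝ} (he : ∀ i, MemLp (e i) 2 μ)
    (hs : ∀ i, MemLp (s i) 2 μ) {G J : Matrix ι ι ℝ} (hG : ∀ i j, ∫ x, e i x * s j x ∂μ = G i j)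
    (hJ : ∀ i j, ∫ x, s i x * s j x ∂μ = J i j) (hGJ : G * J = J) :
    ((Matrix.of fun i j => ∫ x, e i x * e j x ∂μ) - pinv J).PosSemidef := by
  set S : Matrix ι ι ℝ := Matrix.of fun i j => ∫ x, e i x * e j x ∂μ with hS
  have hJt : Jᵀ = J := by
    ext i j
    rw [transpose_apply, ← hJ, ← hJ]
    simp only [mul_comm]
  have hP := isMoorePenrose_pinv J
  have hPt := transpose_pinv hJt
  have hSt : Sᵀ = S := by
    ext i j
    simp [hS, mul_comm]
  have hcomm : pinv J * J = J * pinv J := by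
    have := hP.symm_right
    rwa [transpose_mul, hJt, hPt, eq_comm] at this
  -- Since J is symmetric, J† commutes with J and factors as J(J†J†). Its range lies in that of J,
  -- where G is the identity.
  have hGP : G * pinv J = pinv J := by
    have h1 : pinv J = J * (pinv J * pinv J) := by
      rw [← Matrix.mul_assoc, ← hcomm, hP.mul_mul_inv]
    rw [h1, ← Matrix.mul_assoc, hGJ]
  have hgram := posSemidef_gram_integral (μ := μ) (f := Sum.elim e s) (by
    rintro (i | i)
    · exact he i
    · exact hs i)
  have hblock : (Matrix.of fun i j => ∫ x, Sum.elim e s i x * Sum.elim e s j x ∂μ) =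
      fromBlocks S G Gᵀ J := by
    ext (i | i) (j | j)
    · rfl
    · simp [hG]
    · simp [← hG, mul_comm]
    · simp [hJ]
  rw [hblock] at hgram
  rw [posSemidef_iff_dotProduct_mulVec] at hgram ⊢
  refine ⟨?_, fun v => ?_⟩
  · rw [IsHermitian, conjTranspose_eq_transpose_of_trivial, transpose_sub, hSt, hPt]
  -- The Schur complement choice of second block is -J†Gᵀv, which equals -J†v because GJ† = J†. The
  -- form becomes vᵀSv - 2vᵀJ†v + vᵀJ†v.
  · have h := hgram.2 (Sum.elim v (-(pinv J *ᵥ v)))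
    rw [fromBlocks_mulVec, star_trivial, Sum.elim_comp_inl, Sum.elim_comp_inr,
      sumElim_dotProduct_sumElim] at h
    have e1 : (pinv J *ᵥ v) ⬝ᵥ (Gᵀ *ᵥ v) = v ⬝ᵥ pinv J *ᵥ v := by
      rw [mulVec_transpose, dotProduct_comm, ← dotProduct_mulVec, mulVec_mulVec, hGP]
    have e2 : (pinv J *ᵥ v) ⬝ᵥ (J *ᵥ pinv J *ᵥ v) = v ⬝ᵥ pinv J *ᵥ v := by
      rw [dotProduct_comm, mulVec_mulVec, dotProduct_mulVec, ← mulVec_transpose, hPt,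
        mulVec_mulVec, ← Matrix.mul_assoc, hP.mul_mul_inv, dotProduct_comm]
    simp only [mulVec_neg, dotProduct_add, dotProduct_neg, neg_dotProduct, mulVec_mulVec v G, hGP,
      e1, e2] at h
    rw [sub_mulVec, dotProduct_sub, star_trivial]
    linarith

end CramerRao

/-! ### The Gaussian likelihood as an exponential family -/

section Likelihood

open scoped Matrix.Norms.Operator

section MatrixCalculus

variable {ι : Type*} [Fintype ι] [DecidableEq ι]

theorem differentiable_det : Differentiable ℝ fun A : Matrix ι ι ℝ => A.det := by
  simp only [det_apply]
  fun_prop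

/-- Jacobi's formula. -/
theorem fderiv_det_apply {A : Matrix ι ι ℝ} (hA : IsUnit A.det) (D : Matrix ι ι ℝ) :
    fderiv ℝ (fun A : Matrix ι ι ℝ => A.det) A D = A.det * (A⁻¹ * D).trace := by
  have h1 := ((differentiable_det A).hasFDerivAt.hasLineDerivAt D)
  have h2 : HasLineDerivAt ℝ (fun A : Matrix ι ι ℝ => A.det) (A.det * (A⁻¹ * D).trace) A D := by
    -- Factoring out A leaves det(1 + tA⁻¹D), a polynomial in t whose derivative at 0 is the trace
    -- of A⁻¹D.
    have h3 : ∀ t : ℝ, (A + t • D).det =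
        A.det * (det (1 + (Polynomial.X : Polynomial ℝ) • (A⁻¹ * D).map Polynomial.C)).eval t := by
      intro t
      have h4 : A + t • D = A * (1 + t • (A⁻¹ * D)) := by
        rw [Matrix.mul_add, Matrix.mul_one, Matrix.mul_smul, ← Matrix.mul_assoc,
          mul_nonsing_inv _ hA, Matrix.one_mul]
      rw [h4, det_mul]
      congr 1
      rw [← Polynomial.coe_evalRingHom, RingHom.map_det]
      congr 1
      ext i j
      simp [-Matrix.map_mul, one_apply, apply_ite (Polynomial.eval t)]
      exact mul_comm _ _
    rw [HasLineDerivAt]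
    simp_rw [h3]
    rw [← derivative_det_one_add_X_smul]
    exact (Polynomial.hasDerivAt _ 0).const_mul _
  exact h1.lineDeriv.symm.trans h2.lineDeriv

end MatrixCalculus

variable {m : ℕ} (Sθ : Matrix (Fin (m + 1)) (Fin (m + 1)) ℝ) (α : Param m)

/-- The derivative of the observation covariance at `α` in the direction `v`. -/
noncomputable def obsCovDeriv (v : Param m) : Matrix (Fin m) (Fin m) ℝ :=
  redLap v * redStateCov Sθ * redLap α + redLap α * redStateCov Sθ * redLap v +
    noiseVar v • noiseShape m

theorem hasFDerivAt_obsCov : ∃ C' : Param m →L[ℝ] Matrix (Fin m) (Fin m) ℝ,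
    HasFDerivAt (obsCov Sθ) C' α ∧ ∀ v, C' v = obsCovDeriv Sθ α v := by
  let L : Param m →L[ℝ] Matrix (Fin m) (Fin m) ℝ := LinearMap.toContinuousLinearMap
    { toFun := redLap
      map_add' := fun _ _ => rfl
      map_smul' := fun _ _ => rfl }
  let s : Param m →L[ℝ] ℝ := ContinuousLinearMap.proj (Sum.inr ())
  have h := ((L.hasFDerivAt (x := α)).mul' (hasFDerivAt_const (redStateCov Sθ) α)).mul'
    (L.hasFDerivAt (x := α))
  have h2 := h.add ((s.hasFDerivAt (x := α)).smul_const (noiseShape m))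
  refine ⟨_, h2, fun v => ?_⟩
  change redLap α * redStateCov Sθ * redLap v +
    (redLap α * 0 + redLap v * redStateCov Sθ) * redLap α + noiseVar v • noiseShape m = _
  rw [Matrix.mul_zero, zero_add, obsCovDeriv, add_comm (redLap α * _ * _)]

/-- The natural parameter of the joint Gaussian likelihood of `N` observations: minus the
log-normalizer and the precision matrix. -/
noncomputable def natParam (N : ℕ) (β : Param m) : ℝ × (Fin m → Fin m → ℝ) :=
  (-((N : ℝ) / 2) * Real.log ((2 * Real.pi) ^ m * (obsCov Sθ β).det), Matrix.of.symm (obsCov Sθ β)⁻¹)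

theorem hasFDerivAt_natParam (N : ℕ) (hα : α ∈ paramSpace Sθ) :
    ∃ η' : Param m →L[ℝ] ℝ × (Fin m → Fin m → ℝ), HasFDerivAt (natParam Sθ N) η' α ∧
      ∀ v, η' v = (-((N : ℝ) / 2) * ((obsCov Sθ α)⁻¹ * obsCovDeriv Sθ α v).trace,
        Matrix.of.symm (-((obsCov Sθ α)⁻¹ * obsCovDeriv Sθ α v * (obsCov Sθ α)⁻¹))) := by
  obtain ⟨C', hC', hCv⟩ := hasFDerivAt_obsCov Sθ α
  have hpos := hα.2.det_pos
  have hunit : IsUnit (obsCov Sθ α).det := hpos.ne'.isUnit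
  have hdet := (differentiable_det (obsCov Sθ α)).hasFDerivAt.comp α hC'
  have hlog := ((hdet.const_mul ((2 * Real.pi) ^ m)).log (by
    simp only [Function.comp_apply]
    positivity)).const_mul (-((N : ℝ) / 2))
  obtain ⟨u, hu⟩ := (isUnit_iff_isUnit_det _).2 hunit
  have hring := hasFDerivAt_ringInverse (𝕜 := ℝ) u
  rw [hu] at hring
  let F : Matrix (Fin m) (Fin m) ℝ →L[ℝ] Fin m → Fin m → ℝ :=
    LinearMap.toContinuousLinearMap (Matrix.ofLinearEquiv ℝ).symm.toLinearMap
  have hinv := F.hasFDerivAt.comp α (hring.comp α hC')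
  have hfun : natParam Sθ N = fun β => (-((N : ℝ) / 2) *
      Real.log ((2 * Real.pi) ^ m * ((fun A : Matrix (Fin m) (Fin m) ℝ => A.det) ∘ obsCov Sθ) β),
      (F ∘ (Ring.inverse ∘ obsCov Sθ)) β) := by
    funext β
    simp only [natParam, nonsing_inv_eq_ringInverse, Function.comp_apply]
    rfl
  rw [hfun]
  refine ⟨_, hlog.prodMk hinv, fun v => ?_⟩
  have hui : ((u⁻¹ : (Matrix (Fin m) (Fin m) ℝ)ˣ) : Matrix (Fin m) (Fin m) ℝ) =
      (obsCov Sθ α)⁻¹ := by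
    rw [← hu, coe_units_inv]
  have h2 : (2 * Real.pi) ^ m ≠ 0 := by positivity
  refine Prod.ext ?_ ?_
  · change -((N : ℝ) / 2) * (((2 * Real.pi) ^ m * (obsCov Sθ α).det)⁻¹ * ((2 * Real.pi) ^ m *
      fderiv ℝ (fun A : Matrix (Fin m) (Fin m) ℝ => A.det) (obsCov Sθ α) (C' v))) = _
    rw [fderiv_det_apply hunit, hCv]
    field_simp
  · change Matrix.of.symm (-(((u⁻¹ : (Matrix (Fin m) (Fin m) ℝ)ˣ) : Matrix (Fin m) (Fin m) ℝ) *
      C' v * ((u⁻¹ : (Matrix (Fin m) (Fin m) ℝ)ˣ) : Matrix (Fin m) (Fin m) ℝ))) = _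
    rw [hui, hCv]

/-- The sufficient statistic of the data, as a linear functional of the natural parameter. -/
noncomputable def suffStat {N : ℕ} (x : Fin N → EuclideanSpace ℝ (Fin m)) :
    StrongDual ℝ (ℝ × (Fin m → Fin m → ℝ)) :=
  ContinuousLinearMap.fst ℝ ℝ _ - ∑ n, ∑ i, ∑ j, (x n i * x n j / 2) •
    ((ContinuousLinearMap.proj j : (Fin m → ℝ) →L[ℝ] ℝ).comp (ContinuousLinearMap.proj i)).comp
      (ContinuousLinearMap.snd ℝ ℝ (Fin m → Fin m → ℝ))

variable {N : ℕ}

theorem suffStat_apply (x : Fin N → EuclideanSpace ℝ (Fin m))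
    (p : ℝ × (Fin m → Fin m → ℝ)) :
    suffStat x p = p.1 - (∑ n, quadForm (Matrix.of p.2) (x n)) / 2 := by
  have h : suffStat x p = p.1 - ∑ n, ∑ i, ∑ j, (x n i * x n j / 2) * p.2 i j := by
    simp only [suffStat, _root_.sub_apply, _root_.sum_apply]
    rfl
  rw [h, Finset.sum_div]
  congr 1
  refine Finset.sum_congr rfl fun n _ => ?_
  simp only [quadForm, dotProduct, mulVec, Finset.mul_sum, Finset.sum_div, of_apply]
  refine Finset.sum_congr rfl fun i _ => Finset.sum_congr rfl fun j _ => ?_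
  ring

theorem continuous_suffStat : Continuous fun x : Fin N → EuclideanSpace ℝ (Fin m) => suffStat x := by
  unfold suffStat
  fun_prop

theorem norm_suffStat_le : ∃ K : ℝ, 0 < K ∧ ∀ x : Fin N → EuclideanSpace ℝ (Fin m),
    ‖suffStat x‖ ≤ 1 + K * ∑ n, ‖x n‖ ^ 2 := by
  let P : Fin m → Fin m → StrongDual ℝ (ℝ × (Fin m → Fin m → ℝ)) := fun i j =>
    ((ContinuousLinearMap.proj j : (Fin m → ℝ) →L[ℝ] ℝ).comp (ContinuousLinearMap.proj i)).comp
      (ContinuousLinearMap.snd ℝ ℝ (Fin m → Fin m → ℝ))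
  -- The summand 1 keeps the constant positive even for m = 0; it is divided by later.
  refine ⟨1 + ∑ i, ∑ j, ‖P i j‖, by positivity, fun x => ?_⟩
  have hx : suffStat x = ContinuousLinearMap.fst ℝ ℝ _ -
    ∑ n, ∑ i, ∑ j, (x n i * x n j / 2) • P i j := rfl
  rw [hx]
  refine (norm_sub_le _ _).trans (add_le_add (ContinuousLinearMap.norm_fst_le ..) ?_)
  rw [Finset.mul_sum]
  refine (norm_sum_le _ _).trans (Finset.sum_le_sum fun n _ => ?_)
  have hc : ∀ i j, |x n i * x n j / 2| ≤ ‖x n‖ ^ 2 := by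
    intro i j
    have hi := PiLp.norm_apply_le (x n) i
    have hj := PiLp.norm_apply_le (x n) j
    rw [Real.norm_eq_abs] at hi hj
    rw [abs_div, abs_mul, sq, abs_two]
    have := mul_le_mul hi hj (abs_nonneg _) (norm_nonneg _)
    have := mul_nonneg (abs_nonneg (x n i)) (abs_nonneg (x n j))
    linarith
  calc ‖∑ i, ∑ j, (x n i * x n j / 2) • P i j‖
      ≤ ∑ i, ∑ j, ‖x n‖ ^ 2 * ‖P i j‖ := by
        refine (norm_sum_le _ _).trans (Finset.sum_le_sum fun i _ => ?_)
        refine (norm_sum_le _ _).trans (Finset.sum_le_sum fun j _ => ?_)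
        rw [norm_smul, Real.norm_eq_abs]
        gcongr
        exact hc i j
    _ = (∑ i, ∑ j, ‖P i j‖) * ‖x n‖ ^ 2 := by
        simp only [← Finset.mul_sum, mul_comm]
    _ ≤ (1 + ∑ i, ∑ j, ‖P i j‖) * ‖x n‖ ^ 2 := by
        gcongr
        linarith

/-- Fernique's theorem gives an integrable exp(c‖xₙ‖²) for each sample. As `suffStat` grows
quadratically with constant K, the exponent c/K reduces the claim to a product of these over
independent samples. -/
theorem exists_integrable_exp_norm_suffStat (C : Matrix (Fin m) (Fin m) ℝ) :
    ∃ ε : ℝ, 0 < ε ∧ Integrable (fun x : Fin N → EuclideanSpace ℝ (Fin m) =>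
      Real.exp (ε * ‖suffStat x‖)) (Measure.pi fun _ => multivariateGaussian 0 C) := by
  obtain ⟨K, hK, hle⟩ := norm_suffStat_le (m := m) (N := N)
  obtain ⟨c, hc, hint⟩ := IsGaussian.exists_integrable_exp_sq (multivariateGaussian 0 C)
  refine ⟨c / K, by positivity, ?_⟩
  refine Integrable.mono' ((Integrable.fintype_prod (μ := fun _ : Fin N => multivariateGaussian 0 C)
    fun _ => hint).const_mul (Real.exp (c / K))) ?_ (Filter.Eventually.of_forall fun x => ?_)
  · exact (Real.continuous_exp.comp (continuous_const.mul
      continuous_suffStat.norm)).aestronglyMeasurable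
  · rw [Real.norm_of_nonneg (Real.exp_pos _).le, ← Real.exp_sum, ← Real.exp_add,
      Real.exp_le_exp, ← Finset.mul_sum]
    calc c / K * ‖suffStat x‖ ≤ c / K * (1 + K * ∑ n, ‖x n‖ ^ 2) := by
          gcongr
          exact hle x
      _ = _ := by field_simp

variable {Sθ α}

theorem dataDensity_eq_exp {β : Param m} (hβ : 0 < (obsCov Sθ β).det)
    (x : Fin N → EuclideanSpace ℝ (Fin m)) :
    dataDensity Sθ β x = Real.exp (suffStat x (natParam Sθ N β)) := by
  have hc : 0 < (2 * Real.pi) ^ m * (obsCov Sθ β).det := by positivity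
  rw [dataDensity, suffStat_apply, Finset.prod_mul_distrib, ← Real.exp_sum, sub_eq_add_neg,
    Real.exp_add]
  congr 1
  · rw [Finset.prod_const, Finset.card_univ, Fintype.card_fin, natParam, Real.sqrt_eq_rpow,
      ← Real.rpow_neg hc.le, ← Real.rpow_natCast, ← Real.rpow_mul hc.le,
      Real.rpow_def_of_pos hc]
    congr 1
    ring
  · congr 1
    rw [← Finset.sum_div, Finset.sum_neg_distrib, neg_div]
    rfl

theorem hasFDerivAt_logLik (hα : α ∈ paramSpace Sθ)
    {η' : Param m →L[ℝ] ℝ × (Fin m → Fin m → ℝ)}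
    (hη : HasFDerivAt (natParam Sθ N) η' α) (x : Fin N → EuclideanSpace ℝ (Fin m)) :
    HasFDerivAt (logLik Sθ x) ((suffStat x).comp η') α := by
  refine ((suffStat x).hasFDerivAt.comp α hη).congr_of_eventuallyEq ?_
  obtain ⟨C', hC', -⟩ := hasFDerivAt_obsCov Sθ α
  have hcont : ContinuousAt (fun β => (obsCov Sθ β).det) α :=
    (differentiable_det _).continuousAt.comp hC'.continuousAt
  -- The exponential form needs only det C(β) > 0, an open condition. Hence full differentiability
  -- holds even when σ² = 0 puts α on the boundary of the parameter space.
  filter_upwards [hcont.eventually (lt_mem_nhds hα.2.det_pos)] with β hβ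
  rw [logLik, dataDensity_eq_exp hβ, Real.log_exp]
  rfl

theorem score_eq (hα : α ∈ paramSpace Sθ)
    {η' : Param m →L[ℝ] ℝ × (Fin m → Fin m → ℝ)}
    (hη : HasFDerivAt (natParam Sθ N) η' α) (r : ParamIdx m)
    (x : Fin N → EuclideanSpace ℝ (Fin m)) :
    score Sθ α r x = suffStat x (η' (Pi.single r 1)) :=
  ((hasFDerivAt_logLik hα hη x).hasLineDerivAt _).lineDeriv

end Likelihood

/-! ### The Fisher information matrix -/

section Fisher

variable {m N : ℕ} {Sθ : Matrix (Fin (m + 1)) (Fin (m + 1)) ℝ} {α : Param m}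

open scoped Matrix.Norms.Operator in
theorem hasDerivAt_vec_obsCov (v : Param m) (ij : Fin m × Fin m) :
    HasDerivAt (fun t : ℝ => Matrix.vec (obsCov Sθ (α + t • v)) ij)
      (Matrix.vec (obsCovDeriv Sθ α v) ij) 0 := by
  obtain ⟨C', hC', hCv⟩ := hasFDerivAt_obsCov Sθ α
  have h : HasDerivAt (fun t : ℝ => obsCov Sθ (α + t • v)) (C' v) 0 := hC'.hasLineDerivAt v
  rw [hCv] at h
  -- `Matrix.vec` stacks columns, so the index pair is (column, row) and gets swapped.
  exact (LinearMap.toContinuousLinearMap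
    (entryLinearMap ℝ ℝ ij.2 ij.1)).hasFDerivAt.comp_hasDerivAt (0 : ℝ) h

/-- An off-diagonal parameter fills two symmetric entries. On the diagonal the two elementary
matrices coincide, and the weight 1/2 removes the double count. -/
theorem redLap_single (p : VechIdx m) :
    redLap (Pi.single (Sum.inl p) 1) = (1 - (1 / 2 : ℝ) * (if p.1.1 = p.1.2 then 1 else 0)) •
      (Matrix.single p.1.1 p.1.2 (1 : ℝ) + Matrix.single p.1.2 p.1.1 1) := by
  obtain ⟨⟨k, l⟩, hlk⟩ := p
  ext i j
  have h1 : redLap (Pi.single (Sum.inl (⟨(k, l), hlk⟩ : VechIdx m)) 1) i j =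
      if max i j = k ∧ min i j = l then (1 : ℝ) else 0 := by
    simp [redLap, Pi.single_apply]
  rw [h1]
  simp only [Matrix.smul_apply, Matrix.add_apply, Matrix.single_apply, smul_eq_mul]
  simp only at hlk
  rcases le_total i j with h | h
  · rw [max_eq_right h, min_eq_left h]
    split_ifs <;> first | (exfalso; omega) | norm_num
  · rw [max_eq_left h, min_eq_right h]
    split_ifs <;> first | (exfalso; omega) | norm_num

theorem Psi_apply (ij : Fin m × Fin m) (r : ParamIdx m) :
    Psi Sθ α ij r = Matrix.vec (obsCovDeriv Sθ α (Pi.single r 1)) ij := by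
  rcases r with p | u
  · simp only [Psi, of_apply, Sum.elim_inl, psi, obsCovDeriv, redLap_single, noiseVar, ne_eq,
      reduceCtorEq, not_false_eq_true, Pi.single_eq_of_ne, zero_smul, add_zero, Matrix.smul_mul, Matrix.mul_smul,
      ← smul_add, vec_smul]
  · have h : redLap (Pi.single (Sum.inr u) 1 : Param m) = 0 := by
      ext i j
      simp [redLap]
    simp [Psi, obsCovDeriv, h, noiseVar]

theorem obsCovDeriv_transpose (hS : Sθ.PosSemidef) (v : Param m) :
    (obsCovDeriv Sθ α v)ᵀ = obsCovDeriv Sθ α v := by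
  have hSt : Sθᵀ = Sθ := by
    rw [← conjTranspose_eq_transpose_of_trivial]
    exact hS.isHermitian
  have hR : (redStateCov Sθ)ᵀ = redStateCov Sθ := by
    simp [redStateCov, transpose_mul, hSt, Matrix.mul_assoc]
  have hNs : (noiseShape m)ᵀ = noiseShape m := by
    simp [noiseShape, transpose_mul]
  simp only [obsCovDeriv, transpose_add, transpose_mul, transpose_smul, redLap_transpose, hR, hNs,
    Matrix.mul_assoc]
  rw [add_comm (redLap α * _)]

theorem obsCov_transpose (hα : α ∈ paramSpace Sθ) : (obsCov Sθ α)ᵀ = obsCov Sθ α := by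
  rw [← conjTranspose_eq_transpose_of_trivial]
  exact hα.2.isHermitian

/-- By vec(A)ᵀ(B ⊗ B)vec(D) = tr(AᵀBDBᵀ), with A and B = C⁻¹ symmetric. -/
theorem Psi_transpose_mul_matQ_mul_Psi_apply (hS : Sθ.PosSemidef) (hα : α ∈ paramSpace Sθ)
    (r s : ParamIdx m) : ((Psi Sθ α)ᵀ * matQ Sθ α * Psi Sθ α) r s =
      ((obsCov Sθ α)⁻¹ * obsCovDeriv Sθ α (Pi.single r 1) *
        ((obsCov Sθ α)⁻¹ * obsCovDeriv Sθ α (Pi.single s 1))).trace := by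
  have h1 : ((Psi Sθ α)ᵀ * matQ Sθ α * Psi Sθ α) r s =
      Matrix.vec (obsCovDeriv Sθ α (Pi.single r 1)) ⬝ᵥ
        matQ Sθ α *ᵥ Matrix.vec (obsCovDeriv Sθ α (Pi.single s 1)) := by
    rw [Matrix.mul_assoc, mul_apply]
    simp only [transpose_apply, dotProduct, mulVec, mul_apply, Psi_apply]
  rw [h1, matQ, kronecker_mulVec_vec, vec_dotProduct_vec, transpose_nonsing_inv,
    obsCov_transpose hα, obsCovDeriv_transpose hS, ← Matrix.mul_assoc, trace_mul_comm]
  simp only [Matrix.mul_assoc]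

/-- The first two moments of the directional scores. -/
theorem score_moments (hS : Sθ.PosSemidef) (hα : α ∈ paramSpace Sθ)
    {η' : Param m →L[ℝ] ℝ × (Fin m → Fin m → ℝ)}
    (hη : ∀ v, η' v = (-((N : ℝ) / 2) * ((obsCov Sθ α)⁻¹ * obsCovDeriv Sθ α v).trace,
        Matrix.of.symm (-((obsCov Sθ α)⁻¹ * obsCovDeriv Sθ α v * (obsCov Sθ α)⁻¹))))
    (v : Param m) :
    MemLp (fun x : Fin N → EuclideanSpace ℝ (Fin m) => suffStat x (η' v)) 2 (dataLaw N Sθ α) ∧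
    ∫ x : Fin N → EuclideanSpace ℝ (Fin m), suffStat x (η' v) ∂(dataLaw N Sθ α) = 0 ∧
    ∫ x : Fin N → EuclideanSpace ℝ (Fin m), suffStat x (η' v) ^ 2 ∂(dataLaw N Sθ α) =
      (N : ℝ) / 2 * ((obsCov Sθ α)⁻¹ * obsCovDeriv Sθ α v *
        ((obsCov Sθ α)⁻¹ * obsCovDeriv Sθ α v)).trace := by
  set C := obsCov Sθ α with hC
  set D := obsCovDeriv Sθ α v with hD
  have hCt : Cᵀ = C := obsCov_transpose hα
  have hA : (C⁻¹ * D * C⁻¹).IsHermitian := by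
    rw [IsHermitian, conjTranspose_eq_transpose_of_trivial, transpose_mul, transpose_mul,
      transpose_nonsing_inv, hCt, obsCovDeriv_transpose hS, Matrix.mul_assoc]
  -- The form in the score is A = C⁻¹DC⁻¹, so the moments, which depend on AC, involve only C⁻¹D.
  have hAC : C⁻¹ * D * C⁻¹ * C = C⁻¹ * D := by
    rw [Matrix.mul_assoc, nonsing_inv_mul _ hα.2.det_pos.ne'.isUnit, Matrix.mul_one]
  obtain ⟨h1, h2, h3⟩ := sum_quadForm_pi hA hα.2.posSemidef N
  rw [← hC, hAC] at h2 h3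
  have hprob : IsProbabilityMeasure (dataLaw N Sθ α) := by
    rw [dataLaw_eq hS N hα]
    infer_instance
  rw [← dataLaw_eq hS N hα] at h1 h2 h3
  have hscore : (fun x : Fin N → EuclideanSpace ℝ (Fin m) => suffStat x (η' v)) =
      fun x => 1 / 2 * (∑ n, quadForm (C⁻¹ * D * C⁻¹) (x n)) - (N : ℝ) / 2 * (C⁻¹ * D).trace := by
    funext x
    have hneg : ∀ y : EuclideanSpace ℝ (Fin m), quadForm (-(C⁻¹ * D * C⁻¹)) y =
        -quadForm (C⁻¹ * D * C⁻¹) y := fun y => by simp [quadForm, neg_mulVec]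
    rw [suffStat_apply, hη, ← hD]
    simp only [Equiv.apply_symm_apply, hneg, Finset.sum_neg_distrib]
    ring
  have hmem : MemLp (fun x : Fin N → EuclideanSpace ℝ (Fin m) => suffStat x (η' v)) 2
      (dataLaw N Sθ α) := by
    rw [hscore]
    exact (h1.const_mul _).sub (memLp_const _)
  have hmean : ∫ x : Fin N → EuclideanSpace ℝ (Fin m), suffStat x (η' v) ∂(dataLaw N Sθ α) = 0 := by
    rw [hscore, integral_sub ((h1.integrable one_le_two).const_mul _) (integrable_const _),
      integral_const_mul, h2]
    simp
    ring
  refine ⟨hmem, hmean, ?_⟩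
  have hvar := variance_of_integral_eq_zero hmem.1.aemeasurable hmean
  rw [← hvar, hscore, variance_sub_const (h1.const_mul _).1, variance_const_mul, h3]
  ring

/-- Polarisation: both sides are symmetric bilinear in the directions and agree on the diagonal, so
comparing u + v with u and v suffices. -/
theorem integral_score_mul_score (hS : Sθ.PosSemidef) (hα : α ∈ paramSpace Sθ)
    {η' : Param m →L[ℝ] ℝ × (Fin m → Fin m → ℝ)}
    (hη : ∀ v, η' v = (-((N : ℝ) / 2) * ((obsCov Sθ α)⁻¹ * obsCovDeriv Sθ α v).trace,
        Matrix.of.symm (-((obsCov Sθ α)⁻¹ * obsCovDeriv Sθ α v * (obsCov Sθ α)⁻¹))))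
    (u v : Param m) :
    ∫ x : Fin N → EuclideanSpace ℝ (Fin m), suffStat x (η' u) * suffStat x (η' v)
      ∂(dataLaw N Sθ α) =
      (N : ℝ) / 2 * ((obsCov Sθ α)⁻¹ * obsCovDeriv Sθ α u *
        ((obsCov Sθ α)⁻¹ * obsCovDeriv Sθ α v)).trace := by
  obtain ⟨mu, -, hu⟩ := score_moments hS hα hη u
  obtain ⟨mv, -, hv⟩ := score_moments hS hα hη v
  obtain ⟨-, -, huv⟩ := score_moments hS hα hη (u + v)
  have hD : obsCovDeriv Sθ α (u + v) = obsCovDeriv Sθ α u + obsCovDeriv Sθ α v := by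
    have h1 : redLap (u + v) = redLap u + redLap v := rfl
    have h2 : noiseVar (u + v) = noiseVar u + noiseVar v := rfl
    simp only [obsCovDeriv, h1, h2, Matrix.add_mul, Matrix.mul_add, add_smul]
    abel
  have hexp : ∀ x : Fin N → EuclideanSpace ℝ (Fin m), suffStat x (η' (u + v)) ^ 2 =
      suffStat x (η' u) ^ 2 + suffStat x (η' v) ^ 2 +
        2 * (suffStat x (η' u) * suffStat x (η' v)) := by
    intro x
    rw [map_add, map_add]
    ring
  simp_rw [hexp] at huv
  have hmul : Integrable (fun x : Fin N → EuclideanSpace ℝ (Fin m) =>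
      suffStat x (η' u) * suffStat x (η' v)) (dataLaw N Sθ α) := mu.integrable_mul mv
  have hadd : Integrable (fun x : Fin N → EuclideanSpace ℝ (Fin m) =>
      suffStat x (η' u) ^ 2 + suffStat x (η' v) ^ 2) (dataLaw N Sθ α) :=
    mu.integrable_sq.add mv.integrable_sq
  rw [integral_add hadd (hmul.const_mul 2), integral_add mu.integrable_sq mv.integrable_sq,
    integral_const_mul, hu, hv, hD] at huv
  have hsymm := trace_mul_comm ((obsCov Sθ α)⁻¹ * obsCovDeriv Sθ α v)
    ((obsCov Sθ α)⁻¹ * obsCovDeriv Sθ α u)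
  simp only [Matrix.mul_add, Matrix.add_mul, trace_add, hsymm] at huv
  linarith

/-! ### Means of estimators -/

/-- The likelihood ratio is exp⟨T, η(β) - η(α)⟩. No integrability of h is required: both sides take
the default value 0 together. -/
theorem integral_dataLaw (hS : Sθ.PosSemidef) (hα : α ∈ paramSpace Sθ) {β : Param m}
    (hβ : β ∈ paramSpace Sθ) (h : (Fin N → EuclideanSpace ℝ (Fin m)) → ℝ) :
    ∫ x, h x ∂(dataLaw N Sθ β) =
      ∫ x, h x * Real.exp (suffStat x (natParam Sθ N β - natParam Sθ N α)) ∂(dataLaw N Sθ α) := by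
  have hmeas : ∀ γ ∈ paramSpace Sθ, Measurable fun x : Fin N → EuclideanSpace ℝ (Fin m) =>
      ENNReal.ofReal (dataDensity Sθ γ x) := by
    intro γ hγ
    simp_rw [dataDensity_eq_exp hγ.2.det_pos]
    have := (continuous_suffStat (m := m) (N := N)).clm_apply
      (continuous_const (y := natParam Sθ N γ))
    exact (Real.continuous_exp.comp this).measurable.ennreal_ofReal
  rw [dataLaw_eq_withDensity hS N hβ, dataLaw_eq_withDensity hS N hα,
    integral_withDensity_eq_integral_toReal_smul (hmeas β hβ) (by simp),
    integral_withDensity_eq_integral_toReal_smul (hmeas α hα) (by simp)]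
  refine integral_congr_ae (Filter.Eventually.of_forall fun x => ?_)
  simp only [dataDensity_eq_exp hβ.2.det_pos, dataDensity_eq_exp hα.2.det_pos,
    ENNReal.toReal_ofReal (Real.exp_pos _).le, smul_eq_mul, map_sub, Real.exp_sub]
  field_simp

/-- Chain rule through η, applied to the mean as a function of the natural parameter. The derivative
is only within K because the likelihood-ratio formula for the mean is available on the parameter
space only. -/
theorem hasFDerivWithinAt_estMean (hS : Sθ.PosSemidef) (hα : α ∈ paramSpace Sθ)
    {η' : Param m →L[ℝ] ℝ × (Fin m → Fin m → ℝ)} (hη : HasFDerivAt (natParam Sθ N) η' α)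
    {K : Set (Param m)} (hK : K ⊆ paramSpace Sθ) {est : Estimator m N}
    (hest : ∀ r, MemLp (fun x => est x r) 2 (dataLaw N Sθ α)) :
    ∃ G : Param m →L[ℝ] Param m, HasFDerivWithinAt (estMean Sθ est) G K α ∧
      ∀ v r, G v r = ∫ x, est x r * suffStat x (η' v) ∂(dataLaw N Sθ α) := by
  obtain ⟨ε, hε, hexp⟩ := exists_integrable_exp_norm_suffStat (m := m) (N := N) (obsCov Sθ α)
  have hprob : IsProbabilityMeasure (dataLaw N Sθ α) := by
    rw [dataLaw_eq hS N hα]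
    infer_instance
  rw [← dataLaw_eq hS N hα] at hexp
  have hT : AEStronglyMeasurable (fun x : Fin N → EuclideanSpace ℝ (Fin m) => suffStat x)
      (dataLaw N Sθ α) := continuous_suffStat.aestronglyMeasurable
  have hT2 := memLp_of_integrable_exp_norm hT hε hexp
  refine ⟨ContinuousLinearMap.pi fun r =>
    (∫ x, est x r • suffStat x ∂(dataLaw N Sθ α)).comp η', ?_, fun v r => ?_⟩
  · rw [hasFDerivWithinAt_pi]
    intro r
    have h1 := hasFDerivAt_integral_mul_exp hT hε hexp (hest r)
    -- The base point 0 is written as η(α) - η(α), the value at α of the inner function β ↦ η(β) -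
    -- η(α).
    rw [← sub_self (natParam Sθ N α)] at h1
    have h2 := (HasFDerivAt.comp α h1 (hη.sub_const (natParam Sθ N α))).hasFDerivWithinAt (s := K)
    exact h2.congr (fun β hβ => integral_dataLaw hS hα (hK hβ) _) (integral_dataLaw hS hα hα _)
  · have hint : Integrable (fun x => est x r • suffStat x) (dataLaw N Sθ α) :=
      memLp_one_iff_integrable.1 (hT2.smul (hest r))
    change (∫ x, est x r • suffStat x ∂(dataLaw N Sθ α)) (η' v) = _
    rw [ContinuousLinearMap.integral_apply hint]
    rfl

end Fisher

/-! ### The Cramér-Rao bound -/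

section CramerRaoBound

variable {m N : ℕ} {Sθ : Matrix (Fin (m + 1)) (Fin (m + 1)) ℝ} {α : Param m}

theorem fisherInfo_eq (hS : Sθ.PosSemidef) (hα : α ∈ paramSpace Sθ) :
    fisherInfo N Sθ α = ((N : ℝ) / 2) • ((Psi Sθ α)ᵀ * matQ Sθ α * Psi Sθ α) := by
  obtain ⟨η', hη, hη'⟩ := hasFDerivAt_natParam Sθ α N hα
  ext r s
  simp only [fisherInfo, of_apply, score_eq hα hη]
  rw [integral_score_mul_score hS hα hη', Matrix.smul_apply, smul_eq_mul,
    Psi_transpose_mul_matQ_mul_Psi_apply hS hα]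

theorem IsUnbiasedOn.isUnbiasedToFirstOrder {est : Estimator m N} {K : Set (Param m)}
    (h : IsUnbiasedOn Sθ est K) (hαK : α ∈ K) : IsUnbiasedToFirstOrder Sθ est K α :=
  ⟨ContinuousLinearMap.id ℝ _, (hasFDerivWithinAt_id α K).congr (fun β hβ => (h β hβ).2)
    (h α hαK).2, fun _ => rfl⟩

/-- Uniqueness of derivatives within K makes the assumed derivative equal to the cross-moment
matrix. The scores are centred, so subtracting α from the estimator leaves these cross-moments
unchanged. -/
theorem posSemidef_mseMatrix_sub_crb (hS : Sθ.PosSemidef) (hα : α ∈ paramSpace Sθ)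
    {K : Set (Param m)} (hK : K ⊆ paramSpace Sθ) (hu : UniqueDiffWithinAt ℝ K α)
    {est : Estimator m N} (hest : ∀ r, MemLp (fun x => est x r) 2 (dataLaw N Sθ α))
    (hunb : IsUnbiasedToFirstOrder Sθ est K α) :
    (mseMatrix Sθ est α - crb N Sθ α).PosSemidef := by
  obtain ⟨η', hη, hη'⟩ := hasFDerivAt_natParam Sθ α N hα
  obtain ⟨G, hG, hGv⟩ := hasFDerivWithinAt_estMean hS hα hη hK hest
  obtain ⟨G', hG', hGJ⟩ := hunb
  obtain rfl := hu.eq hG hG'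
  have hprob : IsProbabilityMeasure (dataLaw N Sθ α) := by
    rw [dataLaw_eq hS N hα]
    infer_instance
  have hs := fun r : ParamIdx m => score_moments (N := N) hS hα hη' (Pi.single r 1)
  refine posSemidef_sub_pinv_of_mul_eq (e := fun r x => est x r - α r)
    (s := fun r x => suffStat x (η' (Pi.single r 1))) (G := LinearMap.toMatrix' G.toLinearMap)
    (fun r => (hest r).sub (memLp_const _)) (fun r => (hs r).1) (fun r s => ?_) (fun r s => ?_) ?_
  · have h1 : Integrable (fun x => est x r * suffStat x (η' (Pi.single s 1)))
      (dataLaw N Sθ α) := (hest r).integrable_mul (hs s).1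
    simp_rw [sub_mul]
    rw [integral_sub h1 (((hs s).1.integrable one_le_two).const_mul _), integral_const_mul,
      (hs s).2.1, mul_zero, sub_zero, LinearMap.toMatrix'_apply, ← hGv]
    rfl
  · simp only [fisherInfo, of_apply, score_eq hα hη]
  · refine Matrix.toLin'.injective (LinearMap.ext fun v => ?_)
    rw [toLin'_apply, toLin'_apply, ← mulVec_mulVec, LinearMap.toMatrix'_mulVec]
    exact hGJ v

end CramerRaoBound

end GraphCRB

theorem mainTheorem2 {m N : ℕ} (hN : 0 < N)
    (Sθ : Matrix (Fin (m + 1)) (Fin (m + 1)) ℝ) (hS : Sθ.PosSemidef)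
    (α : GraphCRB.Param m) (hα : α ∈ GraphCRB.paramSpace Sθ) :
    -- each observation is Gaussian with the stated covariance
    GraphCRB.snapshotLaw Sθ α = multivariateGaussian 0 (GraphCRB.obsCov Sθ α) ∧
    -- the likelihood is the density of the data, and the scores exist with finite second moments
    (∀ β ∈ GraphCRB.paramSpace Sθ, GraphCRB.dataLaw N Sθ β =
      volume.withDensity fun x => ENNReal.ofReal (GraphCRB.dataDensity Sθ β x)) ∧
    (∀ x : Fin N → EuclideanSpace ℝ (Fin m),
      DifferentiableAt ℝ (GraphCRB.logLik Sθ x) α) ∧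
    (∀ r, MemLp (GraphCRB.score (N := N) Sθ α r) 2 (GraphCRB.dataLaw N Sθ α)) ∧
    -- the columns of `Ψ` are the vectorized partial derivatives of the observation covariance
    (∀ (r : GraphCRB.ParamIdx m) (ij : Fin m × Fin m),
      HasDerivAt (fun t : ℝ => Matrix.vec (GraphCRB.obsCov Sθ (α + t • Pi.single r 1)) ij)
        (GraphCRB.Psi Sθ α ij r) 0) ∧
    -- the Fisher information matrix
    GraphCRB.fisherInfo N Sθ α = ((N : ℝ) / 2) •
      ((GraphCRB.Psi Sθ α)ᵀ * GraphCRB.matQ Sθ α * GraphCRB.Psi Sθ α) ∧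
    -- the Cramér-Rao bound in closed form
    GraphCRB.crb N Sθ α = (2 / (N : ℝ)) •
      GraphCRB.pinv ((GraphCRB.Psi Sθ α)ᵀ * GraphCRB.matQ Sθ α * GraphCRB.Psi Sθ α) ∧
    -- it bounds the MSE of unbiased estimators, as a whole and blockwise
    (∀ K ⊆ GraphCRB.paramSpace Sθ, α ∈ K → UniqueDiffWithinAt ℝ K α →
      ∀ est : GraphCRB.Estimator m N,
        (∀ r, MemLp (fun x => est x r) 2 (GraphCRB.dataLaw N Sθ α)) →
        (GraphCRB.IsUnbiasedOn Sθ est K ∨ GraphCRB.IsUnbiasedToFirstOrder Sθ est K α) →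
        (GraphCRB.mseMatrix Sθ est α - (2 / (N : ℝ)) •
          GraphCRB.pinv ((GraphCRB.Psi Sθ α)ᵀ * GraphCRB.matQ Sθ α *
            GraphCRB.Psi Sθ α)).PosSemidef ∧
        ((GraphCRB.mseMatrix Sθ est α).toBlocks₁₁ -
          (GraphCRB.crb N Sθ α).toBlocks₁₁).PosSemidef ∧
        GraphCRB.crb N Sθ α (Sum.inr ()) (Sum.inr ()) ≤
          ∫ x, (est x (Sum.inr ()) - GraphCRB.noiseVar α) ^ 2 ∂(GraphCRB.dataLaw N Sθ α)) := by

  obtain ⟨η', hη, hη'⟩ := GraphCRB.hasFDerivAt_natParam Sθ α N hα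
  have hcrb : GraphCRB.crb N Sθ α = (2 / (N : ℝ)) • GraphCRB.pinv
      ((GraphCRB.Psi Sθ α)ᵀ * GraphCRB.matQ Sθ α * GraphCRB.Psi Sθ α) := by
    rw [GraphCRB.crb, GraphCRB.fisherInfo_eq hS hα, GraphCRB.pinv_smul _ (by positivity), inv_div]
  refine ⟨GraphCRB.snapshotLaw_eq hS hα, fun β hβ => GraphCRB.dataLaw_eq_withDensity hS N hβ,
    fun x => (GraphCRB.hasFDerivAt_logLik hα hη x).differentiableAt, fun r => ?_, fun r ij => ?_,
    GraphCRB.fisherInfo_eq hS hα, hcrb, fun K hK hαK hu est hest hunb => ?_⟩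
  · rw [funext (GraphCRB.score_eq hα hη r)]
    exact (GraphCRB.score_moments hS hα hη' _).1
  · rw [GraphCRB.Psi_apply]
    exact GraphCRB.hasDerivAt_vec_obsCov _ ij
  · have h := GraphCRB.posSemidef_mseMatrix_sub_crb hS hα hK hu hest
      (hunb.elim (fun h => h.isUnbiasedToFirstOrder hαK) id)
    -- The bounds for L̃ and σ² are a principal submatrix and a diagonal entry of the full
    -- semidefinite inequality.
    refine ⟨hcrb ▸ h, h.submatrix Sum.inl, ?_⟩
    have h1 := h.diag_nonneg (i := Sum.inr ())
    rw [Matrix.sub_apply, sub_nonneg] at h1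
    refine h1.trans_eq ?_
    simp only [GraphCRB.mseMatrix, of_apply, GraphCRB.noiseVar, sq]
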